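/- For $0<\alpha\le 2$ let $f(\cdot;\alpha)$ be the standard symmetric stable density, i.e. the continuous probability density on $\mathbb R$ with characteristic function $t\mapsto\exp(-|t|^{\alpha})$, so that $f(x;\alpha)=\frac1{2\pi}\int_{\mathbb R}e^{-itx}e^{-|t|^\alpha}\,dt$. Write $f'=\partial f/\partial x$, $f''=\partial^2 f/\partial x^2$, $f_\alpha=\partial f/\partial\alpha$, $f_{\alpha\alpha}=\partial^2 f/\partial\alpha^2$. For $x>0$, $\alpha\neq1$ and $\varphi\in(0,\pi/2)$ put $$g(\varphi)=g(\varphi;\alpha,x)=\left(\frac{x\cos\varphi}{\sin\alpha\varphi}\right)^{\frac{\alpha}{\alpha-1}}\frac{\cos((\alpha-1)\varphi)}{\cos\varphi},$$ $$h_1(\varphi)=\frac1{(\alpha-1)^2}\log\left|\frac{x\cos\varphi}{\sin\alpha\varphi}\right|,\qquad h_2(\varphi)=\frac{\alpha\varphi}{\alpha-1}\,\frac1{\tan\alpha\varphi},\qquad h_3(\varphi)=\varphi\tan((\alpha-1)\varphi),$$ and let $g_\alpha=\partial g/\partial\alpha$. Let $0<\alpha\le2$, $\alpha\ne1$ and $x>0$.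 Then $f(\cdot;\alpha)$ is twice differentiable at $x$, $g$ is differentiable in $\alpha$ for every $\varphi\in(0,\pi/2)$, the integrals below converge absolutely, and $$f'(x;\alpha)=-\frac1x f(x;\alpha)+\frac{\alpha^2\,\mathrm{sign}(\alpha-1)}{\pi x^2(\alpha-1)^2}\int_0^{\pi/2}g(\varphi)(1-g(\varphi))e^{-g(\varphi)}\,d\varphi,$$ $$f''(x;\alpha)=\frac1{\alpha-1}\frac1{x^2}f(x;\alpha)+\frac{3-2\alpha}{\alpha-1}\frac1x f'(x;\alpha)-\frac{\alpha^3\,\mathrm{sign}(\alpha-1)}{\pi(\alpha-1)^3x^3}\int_0^{\pi/2}g(\varphi)^2(2-g(\varphi))e^{-g(\varphi)}\,d\varphi,$$ $$g_\alpha(\varphi)=-g(\varphi)\,\bigl(h_1(\varphi)+h_2(\varphi)+h_3(\varphi)\bigr)\qquad(0<\varphi<\pi/2).$$ If moreover $\alpha<2$, then $f(x;\cdot)$ is twice differentiable at $\alpha$, the integrals below converge absolutely, and $$f_\alpha(x;\alpha)=\frac1{\alpha(1-\alpha)}f(x;\alpha)+\frac{\alpha}{\pi|\alpha-1|x}\int_0^{\pi/2}g_\alpha(\varphi)(1-g(\varphi))e^{-g(\varphi)}\,d\varphi,$$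 $$\begin{aligned}f_{\alpha\alpha}(x;\alpha)={}&\frac{2}{\alpha(1-\alpha)^2}f(x;\alpha)\\&+\frac{2\,\mathrm{sign}(\alpha-1)}{\pi(\alpha-1)^2x}\int_0^{\pi/2}g(\varphi)\{(1+\alpha)h_1(\varphi)+2h_2(\varphi)+h_3(\varphi)\}(1-g(\varphi))e^{-g(\varphi)}\,d\varphi\\&+\frac{\alpha}{\pi|\alpha-1|x}\int_0^{\pi/2}g(\varphi)\bigl(g(\varphi)^2-3g(\varphi)+1\bigr)\{h_1(\varphi)+h_2(\varphi)+h_3(\varphi)\}^2e^{-g(\varphi)}\,d\varphi\\&+\frac{\alpha}{\pi|\alpha-1|x}\int_0^{\pi/2}g(\varphi)\left(\frac{\alpha}{\alpha-1}\frac{\varphi^2}{\sin^2\alpha\varphi}-\frac{\varphi^2}{\cos^2((\alpha-1)\varphi)}\right)(1-g(\varphi))e^{-g(\varphi)}\,d\varphi.\end{aligned}$$ -/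

import Mathlib

noncomputable section

namespace SymStable

open MeasureTheory

/-- The standard symmetric stable density `f(x; α)` with characteristic function
`t ↦ exp (-|t| ^ α)`, given by Fourier inversion:
`f(x; α) = (2π)⁻¹ ∫ exp(-i t x) exp(-|t| ^ α) dt`, where the odd (imaginary) part of the integrand
integrates to zero.  See `eq_density_of_charFun`. -/
def density (x α : ℝ) : ℝ :=
  (2 * Real.pi)⁻¹ * ∫ t : ℝ, Real.cos (t * x) * Real.exp (-|t| ^ α)

/-- `g(φ; α, x)`. -/
def g (φ α x : ℝ) : ℝ :=
  (x * Real.cos φ / Real.sin (α * φ)) ^ (α / (α - 1)) *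
    (Real.cos ((α - 1) * φ) / Real.cos φ)

/-- `h₁(φ)`. -/
def h1 (φ α x : ℝ) : ℝ :=
  1 / (α - 1) ^ 2 * Real.log |x * Real.cos φ / Real.sin (α * φ)|

/-- `h₂(φ)`. -/
def h2 (φ α : ℝ) : ℝ :=
  α * φ / (α - 1) * (1 / Real.tan (α * φ))

/-- `h₃(φ)`. -/
def h3 (φ α : ℝ) : ℝ :=
  φ * Real.tan ((α - 1) * φ)

/-- The partial derivative `g_α = ∂g/∂α`. -/
def gAlpha (φ α x : ℝ) : ℝ :=
  deriv (fun a : ℝ => g φ a x) α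

/-- `f'(x; α) = ∂f/∂x`. -/
def densityX (x α : ℝ) : ℝ :=
  deriv (fun y : ℝ => density y α) x

/-- `f_α(x; α) = ∂f/∂α`. -/
def densityAlpha (x α : ℝ) : ℝ :=
  deriv (fun a : ℝ => density x a) α

lemma integrable_exp_neg_abs_rpow {α : ℝ} (hα : 0 < α) :
    Integrable (fun t : ℝ => Real.exp (-|t| ^ α)) := by
  have h0 : IntegrableOn (fun x : ℝ => Real.exp (-|x| ^ α)) (Set.Ioi 0) := by
    have := integrableOn_rpow_mul_exp_neg_rpow (p := α) (s := 0) (by norm_num) hα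
    refine this.congr_fun (fun x hx => ?_) measurableSet_Ioi
    simp [abs_of_pos (Set.mem_Ioi.mp hx)]
  rw [← integrableOn_univ, ← Set.Iic_union_Ioi (a := (0 : ℝ)), integrableOn_union]
  refine ⟨?_, h0⟩
  rw [← Measure.map_neg_eq_self (volume : Measure ℝ)]
  let m : MeasurableEmbedding fun x : ℝ => -x := (Homeomorph.neg ℝ).measurableEmbedding
  rw [m.integrableOn_map_iff]
  simp_rw [Function.comp_def, abs_neg, Set.neg_preimage, Set.neg_Iic, neg_zero]
  exact Iff.mpr integrableOn_Ici_iff_integrableOn_Ioi h0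

/-- If `p` is a continuous probability density whose law has characteristic function
`exp (-|t| ^ α)`, then `p = density · α`. -/
theorem eq_density_of_charFun {α : ℝ} (hα : 0 < α) {p : ℝ → ℝ} (hc : Continuous p)
    (h0 : ∀ x, 0 ≤ p x) (hp : Integrable p)
    (hchar : ∀ t : ℝ, charFun (volume.withDensity fun x => ENNReal.ofReal (p x)) t =
      Complex.exp (-(|t| ^ α : ℝ))) (x : ℝ) :
    p x = density x α := by
  have hF : FourierTransform.fourier (fun y : ℝ => (p y : ℂ)) =
      fun ξ : ℝ => ((Real.exp (-|2 * Real.pi * ξ| ^ α) : ℝ) : ℂ) := by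
    funext ξ
    have h := hchar (-(2 * Real.pi * ξ))
    rw [charFun_apply_real, integral_withDensity_eq_integral_toReal_smul
      hc.measurable.ennreal_ofReal (by simp)] at h
    rw [Real.fourier_real_eq_integral_exp_smul]
    rw [abs_neg] at h
    rw [Complex.ofReal_exp, Complex.ofReal_neg, ← h]
    congr 1
    funext v
    rw [ENNReal.toReal_ofReal (h0 v), smul_eq_mul, Complex.real_smul, mul_comm]
    push_cast
    ring_nf
  have hpi : (2 * Real.pi) ≠ 0 := by positivity
  have hint : Integrable (FourierTransform.fourier (fun y : ℝ => (p y : ℂ))) := by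
    rw [hF]
    exact ((integrable_exp_neg_abs_rpow hα).comp_mul_left' hpi).ofReal
  have hpc : Integrable (fun y : ℝ => (p y : ℂ)) := hp.ofReal
  have hinv := hpc.fourierInv_fourier_eq hint
    (v := x) (Complex.continuous_ofReal.comp hc).continuousAt
  have hre := congrArg Complex.re hinv
  rw [hF, Real.fourierInv_eq'] at hre
  have hI : Integrable (fun v : ℝ => Complex.exp (((2 * Real.pi * inner ℝ v x : ℝ) : ℂ) *
      Complex.I) • ((Real.exp (-|2 * Real.pi * v| ^ α) : ℝ) : ℂ)) := by
    have hm : Integrable (fun v : ℝ => ((Real.exp (-|2 * Real.pi * v| ^ α) : ℝ) : ℂ)) :=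
      ((integrable_exp_neg_abs_rpow hα).comp_mul_left' hpi).ofReal
    refine hm.bdd_mul (c := 1) ?_ ?_
    · exact Continuous.aestronglyMeasurable (by fun_prop)
    · exact Filter.Eventually.of_forall fun v => (Complex.norm_exp_ofReal_mul_I _).le
  have hre2 := integral_re hI
  simp only [RCLike.re_to_complex] at hre2
  rw [← hre2] at hre
  have hsub := Measure.integral_comp_mul_left
    (fun t : ℝ => Real.cos (t * x) * Real.exp (-|t| ^ α)) (2 * Real.pi)
  rw [abs_of_pos (by positivity), smul_eq_mul] at hsub
  rw [density, ← hsub, ← Complex.ofReal_re (p x), ← hre]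
  congr 1
  funext v
  rw [smul_eq_mul, Complex.re_mul_ofReal, Complex.exp_ofReal_mul_I_re]
  simp [mul_assoc, mul_comm]

end SymStable

end

noncomputable section

namespace SymStable

open MeasureTheory Filter Topology Set

/-! Everything rests on Zolotarev's formula `density_eq_integral`, which expresses the density as an
integral of `g * exp (-g)` over a fixed interval. With z = exp w, the Fourier integral becomes the
increment of Im Q along the real axis of the w-plane, where Q is a primitive of i x z exp(i x z -
z^α). The path is deformed to the curve on which the phase i x z - z^α is real; there it equals `-g`
(`phase_curve`). Up to an exact term that is real on the curve, Q is a multiple of a primitive P of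
phase * exp(phase) (`exists_primitive_phase`). Taking imaginary parts removes both the exact term
and the derivative of the radius, and leaves `g * exp (-g)`. Arc estimates show that curve and axis
give the same limits; for α = 2 the curve ends at a finite radius, and `tendsto_im_primitive_two`
closes the contour there.

The derivatives then come from differentiating under the integral sign
(`hasDerivAt_integral_mul_exp_neg`). Since `g ≥ 0`, any polynomial in `g` times `exp (-g)` is
bounded, so no estimate of `g` itself is needed; only its logarithmic derivative must be dominated.
In x that is α / ((α - 1) x). In α it is `-(h1 + h2 + h3)`, with logarithmic singularities at the
endpoints; `exists_uniform_bounds` dominates it, locally uniformly in α < 2, by a multiple of the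
square-integrable `majorant`. The stated formulas follow from the product rule, with lower-order
integrals traded for f' or cancelled against f_α. -/

/-! ### The curve of real phase -/

/-- `w ↦ i x z - z ^ α` in the logarithmic coordinate `z = exp w`. -/
def phase (α x : ℝ) (w : ℂ) : ℂ :=
  Complex.I * x * Complex.exp w - Complex.exp (α * w)

/-- The logarithm of the radius of the curve on which `phase` is real. -/
def logRadius (α x φ : ℝ) : ℝ :=
  Real.log (x * Real.cos φ / Real.sin (α * φ)) / (α - 1)

lemma phase_re (α x ρ θ : ℝ) : (phase α x (ρ + θ * Complex.I)).re =
    -(x * Real.exp ρ * Real.sin θ) - Real.exp (α * ρ) * Real.cos (α * θ) := by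
  simp only [phase, mul_add, Complex.sub_re, Complex.mul_re, Complex.exp_re, Complex.exp_im,
    Complex.add_re, Complex.add_im, Complex.mul_im]
  simp [mul_assoc]

lemma phase_im (α x ρ θ : ℝ) : (phase α x (ρ + θ * Complex.I)).im =
    x * Real.exp ρ * Real.cos θ - Real.exp (α * ρ) * Real.sin (α * θ) := by
  simp only [phase, mul_add, Complex.sub_im, Complex.mul_re, Complex.exp_re, Complex.exp_im,
    Complex.add_re, Complex.add_im, Complex.mul_im]
  simp [mul_assoc]

lemma hasDerivAt_phase (α x : ℝ) (w : ℂ) :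
    HasDerivAt (phase α x) (Complex.I * x * Complex.exp w - α * Complex.exp (α * w)) w := by
  have h1 := (Complex.hasDerivAt_exp w).const_mul (Complex.I * x)
  have h2 := ((hasDerivAt_id w).const_mul (α : ℂ)).cexp
  refine (h1.sub h2).congr_deriv ?_
  simp only [id, mul_one, mul_comm]

lemma sin_mul_pos {α φ : ℝ} (hα0 : 0 < α) (hα2 : α ≤ 2) (hφ : φ ∈ Ioo 0 (Real.pi / 2)) :
    0 < Real.sin (α * φ) := by
  apply Real.sin_pos_of_pos_of_lt_pi
  · exact mul_pos hα0 hφ.1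
  · nlinarith [hφ.1, hφ.2]

lemma cos_pos_of_mem {φ : ℝ} (hφ : φ ∈ Ioo 0 (Real.pi / 2)) : 0 < Real.cos φ :=
  Real.cos_pos_of_mem_Ioo ⟨by linarith [hφ.1, hφ.2], hφ.2⟩

lemma cos_sub_one_mul_pos {α φ : ℝ} (hα0 : 0 < α) (hα2 : α ≤ 2)
    (hφ : φ ∈ Ioo 0 (Real.pi / 2)) : 0 < Real.cos ((α - 1) * φ) := by
  apply Real.cos_pos_of_mem_Ioo
  constructor <;> nlinarith [hφ.1, hφ.2]

lemma base_pos {α x φ : ℝ} (hα0 : 0 < α) (hα2 : α ≤ 2) (hx : 0 < x)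
    (hφ : φ ∈ Ioo 0 (Real.pi / 2)) : 0 < x * Real.cos φ / Real.sin (α * φ) :=
  div_pos (mul_pos hx (cos_pos_of_mem hφ)) (sin_mul_pos hα0 hα2 hφ)

lemma g_pos {α x φ : ℝ} (hα0 : 0 < α) (hα2 : α ≤ 2) (hx : 0 < x)
    (hφ : φ ∈ Ioo 0 (Real.pi / 2)) : 0 < g φ α x :=
  mul_pos (Real.rpow_pos_of_pos (base_pos hα0 hα2 hx hφ) _)
    (div_pos (cos_sub_one_mul_pos hα0 hα2 hφ) (cos_pos_of_mem hφ))

/-- The radius r satisfies r^(α-1) = x cos φ / sin αφ; multiplying by r gives the form in which r^α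
can be eliminated from the phase. -/
lemma exp_mul_logRadius {α x φ : ℝ} (hα0 : 0 < α) (hα2 : α ≤ 2) (hα1 : α ≠ 1) (hx : 0 < x)
    (hφ : φ ∈ Ioo 0 (Real.pi / 2)) : Real.exp (α * logRadius α x φ) =
      x * Real.cos φ / Real.sin (α * φ) * Real.exp (logRadius α x φ) := by
  have h1 : α - 1 ≠ 0 := sub_ne_zero.mpr hα1
  conv_rhs => rw [← Real.exp_log (base_pos hα0 hα2 hx hφ)]
  rw [← Real.exp_add]
  congr 1
  unfold logRadius
  field_simp
  ring

lemma phase_curve {α x φ : ℝ} (hα0 : 0 < α) (hα2 : α ≤ 2) (hα1 : α ≠ 1) (hx : 0 < x)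
    (hφ : φ ∈ Ioo 0 (Real.pi / 2)) :
    phase α x (logRadius α x φ + φ * Complex.I) = ((-g φ α x : ℝ) : ℂ) := by
  have hs := (sin_mul_pos hα0 hα2 hφ).ne'
  have hc := (cos_pos_of_mem hφ).ne'
  have hE := exp_mul_logRadius hα0 hα2 hα1 hx hφ
  have hL := base_pos hα0 hα2 hx hφ
  apply Complex.ext
  · rw [phase_re, Complex.ofReal_re]
    have hg : (x * Real.cos φ / Real.sin (α * φ)) ^ (α / (α - 1)) =
        Real.exp (α * logRadius α x φ) := by
      rw [Real.rpow_def_of_pos hL]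
      congr 1
      unfold logRadius
      ring
    have hcos : Real.cos ((α - 1) * φ) =
        Real.cos (α * φ) * Real.cos φ + Real.sin (α * φ) * Real.sin φ := by
      rw [sub_mul, one_mul, Real.cos_sub]
    rw [g, hg, hE, hcos]
    field_simp
    ring
  · rw [phase_im, Complex.ofReal_im, hE]
    field_simp
    ring

lemma differentiableAt_logRadius {α x φ : ℝ} (hα0 : 0 < α) (hα2 : α ≤ 2) (hx : 0 < x)
    (hφ : φ ∈ Ioo 0 (Real.pi / 2)) : DifferentiableAt ℝ (logRadius α x) φ := by
  have hs := (sin_mul_pos hα0 hα2 hφ).ne'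
  have hL := (base_pos hα0 hα2 hx hφ).ne'
  unfold logRadius
  apply DifferentiableAt.div_const
  refine DifferentiableAt.log (DifferentiableAt.fun_div ?_ ?_ hs) hL <;> fun_prop

/-! ### Primitives and their values along the curve -/

/-- In phase - phase'/α the z^α terms cancel, leaving ((α - 1)/α) i x z. So the Fourier integrand is
phase * exp(phase) up to a factor and an exact derivative. -/
lemma exists_primitive_phase {α : ℝ} (x : ℝ) (hα0 : 0 < α) (hα1 : α ≠ 1) : ∃ P Q : ℂ → ℂ,
    (∀ w, HasDerivAt P (phase α x w * Complex.exp (phase α x w)) w) ∧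
    (∀ w, HasDerivAt Q (Complex.I * x * Complex.exp w * Complex.exp (phase α x w)) w) ∧
    ∀ w, Q w = (α / (α - 1) : ℝ) * (P w - (1 / α : ℝ) * Complex.exp (phase α x w)) := by
  have hd : Differentiable ℂ (phase α x) := fun w => (hasDerivAt_phase α x w).differentiableAt
  obtain ⟨P, hP⟩ := (hd.mul hd.cexp).isExactOn_univ
  refine ⟨P, _, fun w => hP w (mem_univ _), fun w => ?_, fun w => rfl⟩
  have h := ((hP w (mem_univ _)).sub
    ((hasDerivAt_phase α x w).cexp.const_mul ((1 / α : ℝ) : ℂ))).const_mul ((α / (α - 1) : ℝ) : ℂ)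
  refine h.congr_deriv ?_
  have h1 : (α : ℂ) ≠ 0 := by exact_mod_cast hα0.ne'
  have h2 : (α : ℂ) - 1 ≠ 0 := sub_ne_zero.mpr (by exact_mod_cast hα1)
  simp only [Pi.mul_apply]
  push_cast
  simp only [phase]
  field_simp
  ring

/-- The phase is real on the curve, so exp(phase) contributes nothing to Im Q, and of the velocity
ρ' + i only the i survives in Im P. The value of ρ' is therefore never computed. -/
lemma hasDerivAt_im_primitive_curve {α x φ : ℝ} (hα0 : 0 < α) (hα2 : α ≤ 2) (hα1 : α ≠ 1)
    (hx : 0 < x) {P Q : ℂ → ℂ}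
    (hP : ∀ w, HasDerivAt P (phase α x w * Complex.exp (phase α x w)) w)
    (hPQ : ∀ w, Q w = (α / (α - 1) : ℝ) * (P w - (1 / α : ℝ) * Complex.exp (phase α x w)))
    (hφ : φ ∈ Ioo 0 (Real.pi / 2)) :
    HasDerivAt (fun φ : ℝ => (Q (logRadius α x φ + φ * Complex.I)).im)
      (-(α / (α - 1)) * (g φ α x * Real.exp (-g φ α x))) φ := by
  obtain ⟨ρ', hρ⟩ : ∃ ρ', HasDerivAt (logRadius α x) ρ' φ :=
    ⟨_, (differentiableAt_logRadius hα0 hα2 hx hφ).hasDerivAt⟩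
  have hγ : HasDerivAt (fun φ : ℝ => (logRadius α x φ + φ * Complex.I : ℂ))
      (ρ' + Complex.I) φ := by
    have := hρ.ofReal_comp.fun_add ((hasDerivAt_id φ).ofReal_comp.mul_const Complex.I)
    simpa using this
  have hPγ := (hP (logRadius α x φ + φ * Complex.I)).comp φ hγ
  rw [phase_curve hα0 hα2 hα1 hx hφ] at hPγ
  have him := ((Complex.imCLM.hasFDerivAt.comp_hasDerivAt φ hPγ).const_mul (α / (α - 1)))
  refine (him.congr_of_eventuallyEq ?_).congr_deriv ?_
  · filter_upwards [Ioo_mem_nhds hφ.1 hφ.2] with ψ hψ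
    rw [hPQ, phase_curve hα0 hα2 hα1 hx hψ, Complex.im_ofReal_mul, Complex.sub_im,
      ← Complex.ofReal_exp, ← Complex.ofReal_mul, Complex.ofReal_im, sub_zero]
    rfl
  · rw [← Complex.ofReal_exp, ← Complex.ofReal_mul, Complex.imCLM_apply, Complex.im_ofReal_mul]
    simp

/-! ### Arc estimates and limits at the ends of the contour -/

/-- Mean value inequality along an arc of constant radius and angle at most π/2. The factor exp(-x r
sin θ) is at most 1, so decay for large r needs C > 0, while C = -1 suffices for small r. -/
lemma norm_primitive_sub_le {α x ρ φ C : ℝ} (hx : 0 < x) {Q : ℂ → ℂ}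
    (hQ : ∀ w, HasDerivAt Q (Complex.I * x * Complex.exp w * Complex.exp (phase α x w)) w)
    (hφ : φ ∈ Icc 0 (Real.pi / 2)) (hC : ∀ θ ∈ Icc 0 φ, C ≤ Real.cos (α * θ)) :
    ‖Q (ρ + φ * Complex.I) - Q ρ‖ ≤
      x * Real.exp ρ * Real.exp (-C * Real.exp (α * ρ)) * (Real.pi / 2) := by
  have hd : ∀ θ : ℝ, HasDerivAt (fun θ : ℝ => Q (ρ + θ * Complex.I))
      (Complex.I * x * Complex.exp (ρ + θ * Complex.I) *
        Complex.exp (phase α x (ρ + θ * Complex.I)) * Complex.I) θ := fun θ => by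
    have hγ : HasDerivAt (fun θ : ℝ => (ρ + θ * Complex.I : ℂ)) Complex.I θ := by
      simpa using ((hasDerivAt_id θ).ofReal_comp.mul_const Complex.I).const_add (ρ : ℂ)
    exact (hQ (ρ + θ * Complex.I)).comp θ hγ
  have h := (convex_Icc 0 φ).norm_image_sub_le_of_norm_hasDerivWithin_le
    (C := x * Real.exp ρ * Real.exp (-C * Real.exp (α * ρ)))
    (fun θ _ => (hd θ).hasDerivWithinAt) (fun θ hθ => ?_) (left_mem_Icc.mpr hφ.1)
    (right_mem_Icc.mpr hφ.1)
  · refine (le_of_eq_of_le (by simp) h).trans ?_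
    gcongr
    rw [sub_zero, Real.norm_of_nonneg hφ.1]
    exact hφ.2
  · rw [norm_mul, norm_mul, norm_mul, norm_mul, Complex.norm_I, Complex.norm_exp, Complex.norm_exp,
      phase_re, Complex.norm_real, Real.norm_of_nonneg hx.le]
    simp only [Complex.add_re, Complex.ofReal_re, Complex.mul_re, Complex.I_re, Complex.ofReal_im,
      Complex.I_im, mul_zero, sub_zero, add_zero, one_mul, mul_one]
    gcongr
    have hs : 0 ≤ Real.sin θ := Real.sin_nonneg_of_nonneg_of_le_pi hθ.1
      (by linarith [hθ.2, hφ.2, Real.pi_pos])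
    have h1 : 0 ≤ x * Real.exp ρ * Real.sin θ := by positivity
    have h2 := mul_le_mul_of_nonneg_left (hC θ hθ) (Real.exp_pos (α * ρ)).le
    linarith

lemma tendsto_bound_atBot {α : ℝ} (hα0 : 0 < α) (x : ℝ) :
    Tendsto (fun ρ => x * Real.exp ρ * Real.exp (-(-1) * Real.exp (α * ρ)) * (Real.pi / 2))
      atBot (𝓝 0) := by
  have h1 : Tendsto (fun ρ : ℝ => Real.exp (α * ρ)) atBot (𝓝 0) :=
    Real.tendsto_exp_atBot.comp (tendsto_id.const_mul_atBot hα0)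
  have h2 := (Real.continuous_exp.tendsto _).comp (h1.const_mul (-(-1)))
  have h3 := ((Real.tendsto_exp_atBot.const_mul x).mul h2).mul_const (Real.pi / 2)
  simpa using h3

lemma tendsto_bound_atTop {α C : ℝ} (hα0 : 0 < α) (hC : 0 < C) (x : ℝ) :
    Tendsto (fun ρ => x * Real.exp ρ * Real.exp (-C * Real.exp (α * ρ)) * (Real.pi / 2))
      atTop (𝓝 0) := by
  have h1 : Tendsto (fun ρ : ℝ => Real.exp (α * ρ)) atTop atTop :=
    Real.tendsto_exp_atTop.comp (tendsto_id.const_mul_atTop hα0)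
  -- In the variable s = exp (α ρ), exp ρ is s^(1/α).
  have h2 := (tendsto_rpow_mul_exp_neg_mul_atTop_nhds_zero (1 / α) C hC).comp h1
  have h3 := (h2.const_mul x).mul_const (Real.pi / 2)
  simp only [mul_zero, zero_mul] at h3
  refine h3.congr fun ρ => ?_
  simp only [Function.comp_apply]
  rw [← Real.exp_mul, show α * ρ * (1 / α) = ρ by field_simp, ← mul_assoc x]

lemma continuous_exp_neg_abs_rpow {α : ℝ} (hα0 : 0 < α) :
    Continuous fun u : ℝ => Real.exp (-|u| ^ α) :=
  Real.continuous_exp.comp (continuous_abs.rpow_const fun _ => Or.inr hα0.le).neg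

/-- On the real axis Im Q is, after u = exp ρ, an antiderivative of x cos(ux) exp(-u^α); its total
increment is half of the even Fourier integral times x. -/
lemma exists_limits_im_primitive {α x : ℝ} (hα0 : 0 < α) {Q : ℂ → ℂ}
    (hQ : ∀ w, HasDerivAt Q (Complex.I * x * Complex.exp w * Complex.exp (phase α x w)) w) :
    ∃ c : ℝ, Tendsto (fun ρ : ℝ => (Q ρ).im) atBot (𝓝 c) ∧
      Tendsto (fun ρ : ℝ => (Q ρ).im) atTop (𝓝 (c + Real.pi * x * density x α)) := by
  set k : ℝ → ℝ := fun u => x * (Real.cos (u * x) * Real.exp (-|u| ^ α)) with hk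
  have hkc : Continuous k := by
    have := continuous_exp_neg_abs_rpow hα0
    fun_prop
  set R : ℝ → ℝ := fun t => ∫ u in (0 : ℝ)..t, k u with hR
  have hRd : ∀ t, HasDerivAt R (k t) t := fun t => hkc.integral_hasStrictDerivAt 0 t |>.hasDerivAt
  have hQd : ∀ ρ : ℝ, HasDerivAt (fun ρ : ℝ => (Q ρ).im) (k (Real.exp ρ) * Real.exp ρ) ρ := by
    intro ρ
    have h := Complex.imCLM.hasFDerivAt.comp_hasDerivAt ρ (hQ ρ).comp_ofReal
    refine h.congr_deriv ?_
    have e1 := phase_re α x ρ 0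
    have e2 := phase_im α x ρ 0
    simp only [Complex.ofReal_zero, zero_mul, add_zero, Real.sin_zero, mul_zero, Real.cos_zero,
      mul_one, neg_zero, zero_sub, sub_zero] at e1 e2
    rw [Complex.imCLM_apply, Complex.mul_im, Complex.exp_re, Complex.exp_im, e1, e2, hk]
    simp only [Complex.mul_re, Complex.mul_im, Complex.I_re, Complex.I_im, Complex.ofReal_re,
      Complex.ofReal_im, Complex.exp_ofReal_re, Complex.exp_ofReal_im, abs_of_pos (Real.exp_pos ρ),
      ← Real.exp_mul]
    rw [mul_comm ρ α, mul_comm x (Real.exp ρ)]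
    ring
  have hconst : ∀ ρ : ℝ, (Q ρ).im = R (Real.exp ρ) + ((Q (0 : ℝ)).im - R (Real.exp 0)) := by
    have hd : ∀ ρ : ℝ, HasDerivAt (fun ρ : ℝ => (Q ρ).im - R (Real.exp ρ)) 0 ρ := fun ρ => by
      have := (hQd ρ).sub ((hRd (Real.exp ρ)).comp ρ (Real.hasDerivAt_exp ρ))
      rwa [sub_self] at this
    intro ρ
    have := is_const_of_deriv_eq_zero (fun ρ => (hd ρ).differentiableAt) (fun ρ => (hd ρ).deriv) ρ 0
    linarith
  refine ⟨(Q (0 : ℝ)).im - R (Real.exp 0), ?_, ?_⟩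
  · have h1 : Tendsto (fun ρ => R (Real.exp ρ)) atBot (𝓝 (R 0)) :=
      (hRd 0).continuousAt.tendsto.comp Real.tendsto_exp_atBot
    have h2 := h1.add_const ((Q (0 : ℝ)).im - R (Real.exp 0))
    rw [show R 0 = 0 by simp [hR], zero_add] at h2
    exact h2.congr fun ρ => (hconst ρ).symm
  · have hint : Integrable k := by
      refine Integrable.const_mul ?_ x
      refine (integrable_exp_neg_abs_rpow hα0).bdd_mul (c := 1) ?_ ?_
      · exact Continuous.aestronglyMeasurable (by fun_prop)
      · exact Eventually.of_forall fun u => Real.abs_cos_le_one _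
    have hval : ∫ u in Ioi (0 : ℝ), k u = Real.pi * x * density x α := by
      have e : (fun t : ℝ => Real.cos (t * x) * Real.exp (-|t| ^ α)) =
          fun t => (fun u => Real.cos (u * x) * Real.exp (-u ^ α)) |t| := by
        funext t
        rcases abs_choice t with h | h <;> simp [h]
      rw [density, e, integral_comp_abs (f := fun u => Real.cos (u * x) * Real.exp (-u ^ α)), hk, integral_const_mul]
      have e2 : ∫ u in Ioi (0 : ℝ), Real.cos (u * x) * Real.exp (-|u| ^ α) =
          ∫ u in Ioi (0 : ℝ), Real.cos (u * x) * Real.exp (-u ^ α) :=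
        setIntegral_congr_fun measurableSet_Ioi fun u hu => by
          simp only [abs_of_pos (mem_Ioi.mp hu)]
      have := Real.pi_ne_zero
      rw [e2]
      field_simp
    have h1 := (intervalIntegral_tendsto_integral_Ioi 0 hint.integrableOn
      Real.tendsto_exp_atTop).add_const ((Q (0 : ℝ)).im - R (Real.exp 0))
    rw [hval, add_comm] at h1
    exact h1.congr fun ρ => (hconst ρ).symm

lemma tendsto_im_primitive_of_bound {ι : Type*} {l : Filter ι} {l' : Filter ℝ} {α x C d : ℝ}
    (hx : 0 < x) {Q : ℂ → ℂ}
    (hQ : ∀ w, HasDerivAt Q (Complex.I * x * Complex.exp w * Complex.exp (phase α x w)) w)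
    (hb : Tendsto (fun ρ => x * Real.exp ρ * Real.exp (-C * Real.exp (α * ρ)) * (Real.pi / 2))
      l' (𝓝 0))
    (hd : Tendsto (fun ρ : ℝ => (Q ρ).im) l' (𝓝 d)) {ρ φ : ι → ℝ} (hρ : Tendsto ρ l l')
    (hφ : ∀ᶠ i in l, φ i ∈ Icc 0 (Real.pi / 2))
    (hC : ∀ᶠ i in l, ∀ θ ∈ Icc 0 (φ i), C ≤ Real.cos (α * θ)) :
    Tendsto (fun i => (Q (ρ i + φ i * Complex.I)).im) l (𝓝 d) := by
  have h1 : Tendsto (fun i => (Q (ρ i + φ i * Complex.I)).im - (Q (ρ i)).im) l (𝓝 0) := by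
    refine squeeze_zero_norm' ?_ (hb.comp hρ)
    filter_upwards [hφ, hC] with i h1 h2
    rw [← Complex.sub_im]
    exact (Complex.abs_im_le_norm _).trans (norm_primitive_sub_le hx hQ h1 h2)
  have h2 := h1.add (hd.comp hρ)
  simpa using h2

lemma Ioo_mem_nhdsGT_zero : Ioo 0 (Real.pi / 2) ∈ 𝓝[>] (0 : ℝ) :=
  Ioo_mem_nhdsGT (by positivity)

lemma Ioo_mem_nhdsLT_pi_div_two : Ioo 0 (Real.pi / 2) ∈ 𝓝[<] (Real.pi / 2) :=
  Ioo_mem_nhdsLT (by positivity)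

lemma tendsto_log_base_zero {α x : ℝ} (hα0 : 0 < α) (hα2 : α ≤ 2) (hx : 0 < x) :
    Tendsto (fun φ => Real.log (x * Real.cos φ / Real.sin (α * φ))) (𝓝[>] 0) atTop := by
  apply Real.tendsto_log_atTop.comp
  have h1 : Tendsto (fun φ => x * Real.cos φ) (𝓝[>] 0) (𝓝 x) := by
    have : Continuous fun φ => x * Real.cos φ := by fun_prop
    simpa using (this.tendsto 0).mono_left nhdsWithin_le_nhds
  have h2 : Tendsto (fun φ => Real.sin (α * φ)) (𝓝[>] 0) (𝓝[>] 0) := by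
    apply tendsto_nhdsWithin_of_tendsto_nhds_of_eventually_within
    · have : Continuous fun φ => Real.sin (α * φ) := by fun_prop
      simpa using (this.tendsto 0).mono_left nhdsWithin_le_nhds
    · filter_upwards [Ioo_mem_nhdsGT_zero] with φ hφ using sin_mul_pos hα0 hα2 hφ
  simpa only [div_eq_mul_inv, Pi.inv_apply] using h1.pos_mul_atTop hx h2.inv_tendsto_nhdsGT_zero

lemma sin_mul_pi_div_two_pos {α : ℝ} (hα0 : 0 < α) (hα2 : α < 2) :
    0 < Real.sin (α * (Real.pi / 2)) := by
  apply Real.sin_pos_of_pos_of_lt_pi <;> nlinarith [Real.pi_pos]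

lemma tendsto_log_base_pi_div_two {α x : ℝ} (hα0 : 0 < α) (hα2 : α < 2) (hx : 0 < x) :
    Tendsto (fun φ => Real.log (x * Real.cos φ / Real.sin (α * φ))) (𝓝[<] (Real.pi / 2))
      atBot := by
  apply Real.tendsto_log_nhdsGT_zero.comp
  apply tendsto_nhdsWithin_of_tendsto_nhds_of_eventually_within
  · have h : ContinuousAt (fun φ => x * Real.cos φ / Real.sin (α * φ)) (Real.pi / 2) :=
      ContinuousAt.div (by fun_prop) (by fun_prop) (sin_mul_pi_div_two_pos hα0 hα2).ne'
    simpa using h.tendsto.mono_left nhdsWithin_le_nhds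
  · filter_upwards [Ioo_mem_nhdsLT_pi_div_two] with φ hφ using base_pos hα0 hα2.le hx hφ

lemma measurable_g (α x : ℝ) : Measurable fun φ => g φ α x := by
  unfold g
  fun_prop

lemma pow_mul_exp_neg_le_factorial (n : ℕ) {y : ℝ} (hy : 0 ≤ y) :
    y ^ n * Real.exp (-y) ≤ n.factorial := by
  have h := Real.pow_div_factorial_le_exp y hy n
  rw [div_le_iff₀ (by positivity)] at h
  rw [Real.exp_neg, ← div_eq_mul_inv, div_le_iff₀ (Real.exp_pos y), mul_comm]
  exact h

lemma intervalIntegrable_of_le {k bound : ℝ → ℝ}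
    (hk : AEStronglyMeasurable k (volume.restrict (Ioo 0 (Real.pi / 2))))
    (hb : IntervalIntegrable bound volume 0 (Real.pi / 2))
    (hle : ∀ φ ∈ Ioo 0 (Real.pi / 2), |k φ| ≤ bound φ) :
    IntervalIntegrable k volume 0 (Real.pi / 2) := by
  have hp : (0 : ℝ) ≤ Real.pi / 2 := by positivity
  rw [intervalIntegrable_iff_integrableOn_Ioo_of_le hp] at hb ⊢
  exact Integrable.mono' hb hk ((ae_restrict_iff' measurableSet_Ioo).mpr (.of_forall hle))

lemma intervalIntegrable_g_mul_exp {α x : ℝ} (hα0 : 0 < α) (hα2 : α ≤ 2) (hx : 0 < x) :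
    IntervalIntegrable (fun φ => g φ α x * Real.exp (-g φ α x)) volume 0 (Real.pi / 2) := by
  have hm := measurable_g α x
  refine intervalIntegrable_of_le (bound := fun _ => 1) ?_ (by simp) fun φ hφ => ?_
  · exact Measurable.aestronglyMeasurable (by fun_prop)
  · have hg := (g_pos hα0 hα2 hx hφ).le
    rw [abs_of_nonneg (by positivity)]
    simpa using pow_mul_exp_neg_le_factorial 1 hg

/-- For α = 2 the radius is x / (2 sin φ), which tends to x/2 rather than 0. The gap is closed along
the line Im w = π/2: there the phase and i x z are both real, so Im Q is constant, and it equals its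
limit c at radius 0. -/
lemma tendsto_im_primitive_two {x c : ℝ} (hx : 0 < x) {Q : ℂ → ℂ}
    (hQ : ∀ w, HasDerivAt Q (Complex.I * x * Complex.exp w *
      Complex.exp (phase (2 : ℝ) x w)) w)
    (hc : Tendsto (fun ρ : ℝ => (Q ρ).im) atBot (𝓝 c)) :
    Tendsto (fun φ : ℝ => (Q (logRadius 2 x φ + φ * Complex.I)).im) (𝓝[<] (Real.pi / 2))
      (𝓝 c) := by
  have hcos : ∀ θ : ℝ, -1 ≤ Real.cos (2 * θ) := fun θ => Real.neg_one_le_cos _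
  have hlim : Tendsto (fun ρ : ℝ => (Q (ρ + (Real.pi / 2 : ℝ) * Complex.I)).im) atBot (𝓝 c) :=
    tendsto_im_primitive_of_bound hx hQ (tendsto_bound_atBot two_pos x) hc tendsto_id
      (.of_forall fun _ => ⟨by positivity, le_rfl⟩) (.of_forall fun _ θ _ => hcos θ)
  have hd : ∀ ρ : ℝ, HasDerivAt
      (fun ρ : ℝ => (Q (ρ + (Real.pi / 2 : ℝ) * Complex.I)).im) 0 ρ := by
    intro ρ
    have hγ : HasDerivAt (fun ρ : ℝ => (ρ + (Real.pi / 2 : ℝ) * Complex.I : ℂ)) 1 ρ := by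
      simpa using (hasDerivAt_id ρ).ofReal_comp.add_const ((Real.pi / 2 : ℝ) * Complex.I)
    have h := Complex.imCLM.hasFDerivAt.comp_hasDerivAt ρ ((hQ _).comp ρ hγ)
    refine h.congr_deriv ?_
    have e1 : phase (2 : ℝ) x (ρ + (Real.pi / 2 : ℝ) * Complex.I) =
        ((phase (2 : ℝ) x (ρ + (Real.pi / 2 : ℝ) * Complex.I)).re : ℂ) := by
      apply Complex.ext
      · simp
      · rw [phase_im, Complex.ofReal_im, Real.cos_pi_div_two, mul_div_cancel₀ _ two_ne_zero,
          Real.sin_pi]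
        ring
    rw [e1, Complex.imCLM_apply, mul_one, ← Complex.ofReal_exp, Complex.im_mul_ofReal,
      Complex.mul_im, Complex.exp_re, Complex.exp_im]
    simp
  have hconst : ∀ ρ : ℝ, (Q (ρ + (Real.pi / 2 : ℝ) * Complex.I)).im = c := by
    intro ρ
    have h : (fun _ : ℝ => (Q (ρ + (Real.pi / 2 : ℝ) * Complex.I)).im) =
        fun ρ : ℝ => (Q (ρ + (Real.pi / 2 : ℝ) * Complex.I)).im := by
      funext σ
      exact is_const_of_deriv_eq_zero (fun ρ => (hd ρ).differentiableAt) (fun ρ => (hd ρ).deriv) ρ σ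
    rw [← h] at hlim
    exact tendsto_nhds_unique tendsto_const_nhds hlim
  have hrad : Tendsto (logRadius 2 x) (𝓝[<] (Real.pi / 2)) (𝓝 (Real.log (x / 2))) := by
    have h : ContinuousAt (fun φ => Real.log (x / (2 * Real.sin φ))) (Real.pi / 2) := by
      refine ContinuousAt.log (ContinuousAt.div (by fun_prop) (by fun_prop) ?_) ?_
      · simp
      · simp [hx.ne']
    have h2 := h.tendsto.mono_left (nhdsWithin_le_nhds (s := Iio (Real.pi / 2)))
    rw [Real.sin_pi_div_two, mul_one] at h2
    refine h2.congr' ?_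
    filter_upwards [Ioo_mem_nhdsLT_pi_div_two] with φ hφ
    have := (cos_pos_of_mem hφ).ne'
    rw [logRadius, Real.sin_two_mul, show (2 : ℝ) - 1 = 1 by norm_num, div_one]
    congr 1
    field_simp
  have hcont : Continuous Q := continuous_iff_continuousAt.mpr fun w => (hQ w).continuousAt
  have hpt : Tendsto (fun φ : ℝ => (logRadius 2 x φ + φ * Complex.I : ℂ)) (𝓝[<] (Real.pi / 2))
      (𝓝 ((Real.log (x / 2) : ℝ) + (Real.pi / 2 : ℝ) * Complex.I)) := by
    refine ((Complex.continuous_ofReal.tendsto _).comp hrad).add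
      (Tendsto.mul_const _ ((Complex.continuous_ofReal.tendsto _).mono_left nhdsWithin_le_nhds))
  have := (Complex.continuous_im.tendsto _).comp ((hcont.tendsto _).comp hpt)
  rw [hconst] at this
  exact this

lemma eventually_le_cos_mul {α : ℝ} (hα0 : 0 < α) :
    ∀ᶠ φ in 𝓝[>] (0 : ℝ), ∀ θ ∈ Icc 0 φ, 1 / 2 ≤ Real.cos (α * θ) := by
  have h : Ioo 0 (Real.pi / (3 * α)) ∈ 𝓝[>] (0 : ℝ) := Ioo_mem_nhdsGT (by positivity)
  filter_upwards [h] with φ hφ θ hθ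
  rw [← Real.cos_pi_div_three]
  have h1 : α * θ ≤ Real.pi / 3 := by
    have := mul_le_mul_of_nonneg_left (hθ.2.trans hφ.2.le) hα0.le
    refine this.trans (le_of_eq ?_)
    field_simp
  exact Real.cos_le_cos_of_nonneg_of_le_pi (mul_nonneg hα0.le hθ.1)
    (by linarith [Real.pi_pos]) h1

/-- Zolotarev's integral representation of the symmetric stable density. -/
theorem density_eq_integral {α x : ℝ} (hα0 : 0 < α) (hα2 : α ≤ 2) (hα1 : α ≠ 1) (hx : 0 < x) :
    density x α = α / (Real.pi * |α - 1| * x) *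
      ∫ φ in (0 : ℝ)..(Real.pi / 2), g φ α x * Real.exp (-g φ α x) := by
  obtain ⟨P, Q, hP, hQ, hPQ⟩ := exists_primitive_phase x hα0 hα1
  obtain ⟨c, hbot, htop⟩ := exists_limits_im_primitive hα0 hQ
  have hderiv := fun φ (hφ : φ ∈ Ioo 0 (Real.pi / 2)) =>
    hasDerivAt_im_primitive_curve hα0 hα2 hα1 hx hP hPQ hφ
  have hint := (intervalIntegrable_g_mul_exp hα0 hα2 hx).const_mul (-(α / (α - 1)))
  have hpi : (0 : ℝ) < Real.pi / 2 := by positivity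
  have hF0 : ∀ᶠ φ in 𝓝[>] (0 : ℝ), φ ∈ Icc 0 (Real.pi / 2) := by
    filter_upwards [Ioo_mem_nhdsGT_zero] with φ hφ using ⟨hφ.1.le, hφ.2.le⟩
  have hF1 : ∀ᶠ φ in 𝓝[<] (Real.pi / 2), φ ∈ Icc 0 (Real.pi / 2) := by
    filter_upwards [Ioo_mem_nhdsLT_pi_div_two] with φ hφ using ⟨hφ.1.le, hφ.2.le⟩
  have hneg : ∀ θ : ℝ, -1 ≤ Real.cos (α * θ) := fun θ => Real.neg_one_le_cos _
  have hb0 := tendsto_bound_atBot hα0 x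
  have hpi0 := Real.pi_ne_zero
  rcases lt_or_gt_of_ne hα1 with h1 | h1
  -- For α < 1 the radius runs from 0 to ∞. For α > 1 it runs from ∞ down, which reverses the sign
  -- and accounts for |α - 1|.
  · have h1' : α - 1 < 0 := by linarith
    have hl : Tendsto (fun φ : ℝ => (Q (logRadius α x φ + φ * Complex.I)).im) (𝓝[>] 0) (𝓝 c) :=
      tendsto_im_primitive_of_bound hx hQ hb0 hbot
        ((tendsto_log_base_zero hα0 hα2 hx).atTop_div_const_of_neg h1') hF0
        (.of_forall fun _ θ _ => hneg θ)
    have hcos : 0 < Real.cos (α * (Real.pi / 2)) := by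
      apply Real.cos_pos_of_mem_Ioo
      constructor <;> nlinarith
    have hr : Tendsto (fun φ : ℝ => (Q (logRadius α x φ + φ * Complex.I)).im)
        (𝓝[<] (Real.pi / 2)) (𝓝 (c + Real.pi * x * density x α)) := by
      have hrad : Tendsto (logRadius α x) (𝓝[<] (Real.pi / 2)) atTop := by
        have h := (tendsto_log_base_pi_div_two hα0 (by linarith) hx).atBot_mul_const_of_neg
          (inv_lt_zero.mpr h1')
        exact h.congr fun φ => (div_eq_mul_inv _ _).symm
      -- Here αθ ≤ απ/2 < π/2, so C = cos(απ/2) > 0 works on the whole arc.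
      refine tendsto_im_primitive_of_bound hx hQ (tendsto_bound_atTop hα0 hcos x) htop hrad hF1 ?_
      filter_upwards [hF1] with φ hφ θ hθ
      refine Real.cos_le_cos_of_nonneg_of_le_pi (mul_nonneg hα0.le hθ.1) (by nlinarith) ?_
      exact mul_le_mul_of_nonneg_left (hθ.2.trans hφ.2) hα0.le
    have h := intervalIntegral.integral_eq_sub_of_hasDerivAt_of_tendsto hpi hderiv hint hl hr
    rw [intervalIntegral.integral_const_mul] at h
    have h2 : α - 1 ≠ 0 := h1'.ne
    rw [abs_of_neg h1']
    field_simp at h ⊢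
    linarith
  · have h1' : 0 < α - 1 := by linarith
    have hl : Tendsto (fun φ : ℝ => (Q (logRadius α x φ + φ * Complex.I)).im) (𝓝[>] 0)
        (𝓝 (c + Real.pi * x * density x α)) :=
      tendsto_im_primitive_of_bound hx hQ (tendsto_bound_atTop hα0 one_half_pos x) htop
        ((tendsto_log_base_zero hα0 hα2 hx).atTop_div_const h1') hF0 (eventually_le_cos_mul hα0)
    have hr : Tendsto (fun φ : ℝ => (Q (logRadius α x φ + φ * Complex.I)).im)
        (𝓝[<] (Real.pi / 2)) (𝓝 c) := by
      rcases hα2.lt_or_eq with h2 | rfl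
      · exact tendsto_im_primitive_of_bound hx hQ hb0 hbot
          ((tendsto_log_base_pi_div_two hα0 h2 hx).atBot_div_const h1') hF1
          (.of_forall fun _ θ _ => hneg θ)
      · exact tendsto_im_primitive_two hx hQ hbot
    have h := intervalIntegral.integral_eq_sub_of_hasDerivAt_of_tendsto hpi hderiv hint hl hr
    rw [intervalIntegral.integral_const_mul] at h
    have h2 : α - 1 ≠ 0 := h1'.ne'
    rw [abs_of_pos h1']
    field_simp at h ⊢
    linarith

/-! ### Differentiation under the integral sign -/

lemma ae_mem_Ioo_of_mem_uIoc {p : ℝ → Prop} (h : ∀ φ ∈ Ioo 0 (Real.pi / 2), p φ) :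
    ∀ᵐ φ : ℝ, φ ∈ uIoc 0 (Real.pi / 2) → p φ := by
  have hne : ∀ᵐ φ : ℝ, φ ≠ Real.pi / 2 := by simp [ae_iff, measure_singleton]
  filter_upwards [hne] with φ h1 h2
  rw [uIoc_of_le (by positivity)] at h2
  exact h φ ⟨h2.1, lt_of_le_of_ne h2.2 h1⟩

lemma abs_mul_one_sub_mul_exp_le {y : ℝ} (hy : 0 ≤ y) :
    |y * (1 - y) * Real.exp (-y)| ≤ 3 := by
  have h1 := pow_mul_exp_neg_le_factorial 1 hy
  have h2 := pow_mul_exp_neg_le_factorial 2 hy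
  have h3 : 0 ≤ y ^ 1 * Real.exp (-y) := by positivity
  have h4 : 0 ≤ y ^ 2 * Real.exp (-y) := by positivity
  norm_num [Nat.factorial] at h1 h2 h3
  rw [abs_le]
  constructor <;> nlinarith

lemma abs_sq_mul_two_sub_mul_exp_le {y : ℝ} (hy : 0 ≤ y) :
    |y ^ 2 * (2 - y) * Real.exp (-y)| ≤ 10 := by
  have h1 := pow_mul_exp_neg_le_factorial 2 hy
  have h2 := pow_mul_exp_neg_le_factorial 3 hy
  have h3 : 0 ≤ y ^ 2 * Real.exp (-y) := by positivity
  have h4 : 0 ≤ y ^ 3 * Real.exp (-y) := by positivity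
  norm_num [Nat.factorial] at h1 h2
  rw [abs_le]
  constructor <;> nlinarith

lemma abs_mul_quadratic_mul_exp_le {y : ℝ} (hy : 0 ≤ y) :
    |y * (y ^ 2 - 3 * y + 1) * Real.exp (-y)| ≤ 13 := by
  have h0 := abs_mul_one_sub_mul_exp_le hy
  have h1 := abs_sq_mul_two_sub_mul_exp_le hy
  have h2 : y * (y ^ 2 - 3 * y + 1) * Real.exp (-y) =
      y * (1 - y) * Real.exp (-y) - y ^ 2 * (2 - y) * Real.exp (-y) := by ring
  rw [h2]
  exact (abs_sub _ _).trans (by linarith)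

/-- Differentiating `∫ G * exp (-G)` twice with respect to a parameter on which `G` depends with
logarithmic derivative `W`. -/
lemma hasDerivAt_integral_mul_exp_neg {G W W' : ℝ → ℝ → ℝ} {m : ℝ → ℝ} {s₀ ε K : ℝ} (hε : 0 < ε)
    (hm : IntervalIntegrable (fun φ => m φ ^ 2) volume 0 (Real.pi / 2))
    (hm1 : ∀ φ ∈ Ioo 0 (Real.pi / 2), 1 ≤ m φ)
    (hGm : ∀ s, Measurable (G s)) (hWm : ∀ s, Measurable (W s)) (hWm' : ∀ s, Measurable (W' s))
    (hG0 : ∀ s ∈ Metric.ball s₀ ε, ∀ φ ∈ Ioo 0 (Real.pi / 2), 0 ≤ G s φ)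
    (hG : ∀ s ∈ Metric.ball s₀ ε, ∀ φ ∈ Ioo 0 (Real.pi / 2),
      HasDerivAt (fun s => G s φ) (G s φ * W s φ) s)
    (hW : ∀ s ∈ Metric.ball s₀ ε, ∀ φ ∈ Ioo 0 (Real.pi / 2),
      HasDerivAt (fun s => W s φ) (W' s φ) s)
    (hWb : ∀ s ∈ Metric.ball s₀ ε, ∀ φ ∈ Ioo 0 (Real.pi / 2), |W s φ| ≤ K * m φ)
    (hWb' : ∀ s ∈ Metric.ball s₀ ε, ∀ φ ∈ Ioo 0 (Real.pi / 2), |W' s φ| ≤ K * m φ) :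
    (∀ s ∈ Metric.ball s₀ ε,
      HasDerivAt (fun s => ∫ φ in (0 : ℝ)..(Real.pi / 2), G s φ * Real.exp (-G s φ))
        (∫ φ in (0 : ℝ)..(Real.pi / 2), G s φ * W s φ * (1 - G s φ) * Real.exp (-G s φ)) s) ∧
    HasDerivAt (fun s => ∫ φ in (0 : ℝ)..(Real.pi / 2),
        G s φ * W s φ * (1 - G s φ) * Real.exp (-G s φ))
      (∫ φ in (0 : ℝ)..(Real.pi / 2),
        (G s₀ φ * (G s₀ φ ^ 2 - 3 * G s₀ φ + 1) * W s₀ φ ^ 2 * Real.exp (-G s₀ φ) +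
          G s₀ φ * W' s₀ φ * (1 - G s₀ φ) * Real.exp (-G s₀ φ))) s₀ := by
  have hK : ∀ φ ∈ Ioo 0 (Real.pi / 2), 0 ≤ K := fun φ hφ => by
    have h1 := (abs_nonneg _).trans (hWb s₀ (Metric.mem_ball_self hε) φ hφ)
    exact nonneg_of_mul_nonneg_left h1 (by linarith [hm1 φ hφ])
  have hb1 : ∀ s ∈ Metric.ball s₀ ε, ∀ φ ∈ Ioo 0 (Real.pi / 2),
      |G s φ * W s φ * (1 - G s φ) * Real.exp (-G s φ)| ≤ 3 * K * m φ ^ 2 := by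
    intro s hs φ hφ
    have e : G s φ * W s φ * (1 - G s φ) * Real.exp (-G s φ) =
      G s φ * (1 - G s φ) * Real.exp (-G s φ) * W s φ := by ring
    have h1 := hm1 φ hφ
    -- Since `m ≥ 1`, integrability of `m ^ 2` also covers the terms linear in W.
    have h2 : K * m φ ≤ K * m φ ^ 2 := mul_le_mul_of_nonneg_left (by nlinarith) (hK φ hφ)
    rw [e, abs_mul, mul_assoc 3]
    exact mul_le_mul (abs_mul_one_sub_mul_exp_le (hG0 s hs φ hφ)) ((hWb s hs φ hφ).trans h2)
      (abs_nonneg _) (by norm_num)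
  have hb2 : ∀ s ∈ Metric.ball s₀ ε, ∀ φ ∈ Ioo 0 (Real.pi / 2),
      |G s φ * (G s φ ^ 2 - 3 * G s φ + 1) * W s φ ^ 2 * Real.exp (-G s φ) +
          G s φ * W' s φ * (1 - G s φ) * Real.exp (-G s φ)| ≤ (13 * K ^ 2 + 3 * K) * m φ ^ 2 := by
    intro s hs φ hφ
    have e : G s φ * (G s φ ^ 2 - 3 * G s φ + 1) * W s φ ^ 2 * Real.exp (-G s φ) +
          G s φ * W' s φ * (1 - G s φ) * Real.exp (-G s φ) =
      G s φ * (G s φ ^ 2 - 3 * G s φ + 1) * Real.exp (-G s φ) * W s φ ^ 2 +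
        G s φ * (1 - G s φ) * Real.exp (-G s φ) * W' s φ := by ring
    have h1 := hm1 φ hφ
    have h2 : K * m φ ≤ K * m φ ^ 2 := mul_le_mul_of_nonneg_left (by nlinarith) (hK φ hφ)
    have h3 : |W s φ ^ 2| ≤ K ^ 2 * m φ ^ 2 := by
      rw [abs_pow, ← mul_pow]
      exact pow_le_pow_left₀ (abs_nonneg _) (hWb s hs φ hφ) 2
    rw [e]
    refine (abs_add_le _ _).trans ?_
    rw [abs_mul _ (W s φ ^ 2), abs_mul _ (W' s φ), add_mul, mul_assoc 13, mul_assoc 3]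
    exact add_le_add (mul_le_mul (abs_mul_quadratic_mul_exp_le (hG0 s hs φ hφ)) h3
        (abs_nonneg _) (by norm_num))
      (mul_le_mul (abs_mul_one_sub_mul_exp_le (hG0 s hs φ hφ)) ((hWb' s hs φ hφ).trans h2)
        (abs_nonneg _) (by norm_num))
  have hexp : ∀ s ∈ Metric.ball s₀ ε, ∀ φ ∈ Ioo 0 (Real.pi / 2),
      HasDerivAt (fun s => Real.exp (-G s φ)) (Real.exp (-G s φ) * -(G s φ * W s φ)) s :=
    fun s hs φ hφ => (hG s hs φ hφ).fun_neg.exp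
  have hF1m : ∀ s, Measurable fun φ => G s φ * W s φ * (1 - G s φ) * Real.exp (-G s φ) :=
    fun s => by
      have := hGm s
      have := hWm s
      fun_prop
  have hF2m : ∀ s, Measurable fun φ =>
      (G s φ * (G s φ ^ 2 - 3 * G s φ + 1) * W s φ ^ 2 * Real.exp (-G s φ) +
          G s φ * W' s φ * (1 - G s φ) * Real.exp (-G s φ)) :=
    fun s => by
      have := hGm s
      have := hWm s
      have := hWm' s
      fun_prop
  constructor
  · intro s hs
    refine (intervalIntegral.hasDerivAt_integral_of_dominated_loc_of_deriv_le
      (F := fun s φ => G s φ * Real.exp (-G s φ))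
      (F' := fun s φ => G s φ * W s φ * (1 - G s φ) * Real.exp (-G s φ))
      (s := Metric.ball s₀ ε) (bound := fun φ => 3 * K * m φ ^ 2)
      (Metric.isOpen_ball.mem_nhds hs) (.of_forall fun s => ?_) ?_
      (hF1m s).aestronglyMeasurable
      (ae_mem_Ioo_of_mem_uIoc fun φ hφ s hs => hb1 s hs φ hφ) (hm.const_mul _)
      (ae_mem_Ioo_of_mem_uIoc fun φ hφ s hs => ?_)).2
    · have := hGm s
      exact Measurable.aestronglyMeasurable (by fun_prop)
    · have := hGm s
      refine intervalIntegrable_of_le (bound := fun _ => 1)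
        (Measurable.aestronglyMeasurable (by fun_prop)) (by simp) fun φ hφ => ?_
      have hg := hG0 s hs φ hφ
      rw [abs_of_nonneg (by positivity)]
      simpa using pow_mul_exp_neg_le_factorial 1 hg
    · refine ((hG s hs φ hφ).fun_mul (hexp s hs φ hφ)).congr_deriv ?_
      ring
  · have hs₀ := Metric.mem_ball_self (x := s₀) hε
    refine (intervalIntegral.hasDerivAt_integral_of_dominated_loc_of_deriv_le
      (F := fun s φ => G s φ * W s φ * (1 - G s φ) * Real.exp (-G s φ))
      (F' := fun s φ => (G s φ * (G s φ ^ 2 - 3 * G s φ + 1) * W s φ ^ 2 * Real.exp (-G s φ) +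
          G s φ * W' s φ * (1 - G s φ) * Real.exp (-G s φ)))
      (s := Metric.ball s₀ ε) (bound := fun φ => (13 * K ^ 2 + 3 * K) * m φ ^ 2)
      (Metric.ball_mem_nhds s₀ hε) (.of_forall fun s => (hF1m s).aestronglyMeasurable) ?_
      (hF2m s₀).aestronglyMeasurable
      (ae_mem_Ioo_of_mem_uIoc fun φ hφ s hs => hb2 s hs φ hφ) (hm.const_mul _)
      (ae_mem_Ioo_of_mem_uIoc fun φ hφ s hs => ?_)).2
    · exact intervalIntegrable_of_le (hF1m s₀).aestronglyMeasurable (hm.const_mul _) (hb1 s₀ hs₀)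
    · refine ((((hG s hs φ hφ).fun_mul (hW s hs φ hφ)).fun_mul
        ((hG s hs φ hφ).const_sub 1)).fun_mul (hexp s hs φ hφ)).congr_deriv ?_
      ring

/-! ### Endpoint singularities -/

/-- A square-integrable majorant for the logarithmic singularities at both ends of `(0, π / 2)`. -/
def majorant (φ : ℝ) : ℝ :=
  1 + φ ^ (-(1 / 4) : ℝ) + (Real.pi / 2 - φ) ^ (-(1 / 4) : ℝ)

lemma one_le_majorant {φ : ℝ} (hφ : φ ∈ Ioo 0 (Real.pi / 2)) : 1 ≤ majorant φ := by
  have h1 := Real.rpow_nonneg hφ.1.le (-(1 / 4))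
  have h2 := Real.rpow_nonneg (sub_pos.mpr hφ.2).le (-(1 / 4))
  unfold majorant
  linarith

lemma rpow_neg_quarter_sq {y : ℝ} (hy : 0 ≤ y) :
    (y ^ (-(1 / 4) : ℝ)) ^ 2 = y ^ (-(1 / 2) : ℝ) := by
  rw [← Real.rpow_natCast, ← Real.rpow_mul hy]
  norm_num

lemma intervalIntegrable_majorant_sq :
    IntervalIntegrable (fun φ => majorant φ ^ 2) volume 0 (Real.pi / 2) := by
  have h1 : IntervalIntegrable (fun φ : ℝ => φ ^ (-(1 / 2) : ℝ)) volume 0 (Real.pi / 2) :=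
    intervalIntegral.intervalIntegrable_rpow' (by norm_num)
  have h2 := (h1.comp_sub_left (Real.pi / 2)).symm
  simp only [sub_self, sub_zero] at h2
  -- The factor 3 is that of (1 + u + v)² ≤ 3 (1 + u² + v²).
  have h3 := (((intervalIntegrable_const (c := (1 : ℝ))).add h1).add h2).const_mul 3
  refine intervalIntegrable_of_le ?_ h3 fun φ hφ => ?_
  · have : Measurable majorant := by
      unfold majorant
      fun_prop
    exact Measurable.aestronglyMeasurable (by fun_prop)
  · rw [abs_of_nonneg (sq_nonneg _), ← rpow_neg_quarter_sq hφ.1.le,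
      ← rpow_neg_quarter_sq (sub_pos.mpr hφ.2).le, majorant]
    generalize φ ^ (-(1 / 4) : ℝ) = u
    generalize (Real.pi / 2 - φ) ^ (-(1 / 4) : ℝ) = v
    nlinarith [sq_nonneg (1 - u), sq_nonneg (1 - v), sq_nonneg (u - v)]

lemma abs_log_le_rpow {u : ℝ} (h0 : 0 < u) (h2 : u ≤ 2) :
    |Real.log u| ≤ 1 + 4 * u ^ (-(1 / 4) : ℝ) := by
  have hp := Real.rpow_nonneg h0.le (-(1 / 4))
  have h3 := Real.log_le_sub_one_of_pos h0
  have h4 := Real.log_le_rpow_div (inv_pos.mpr h0).le (show (0 : ℝ) < 1 / 4 by norm_num)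
  rw [Real.log_inv, Real.inv_rpow h0.le, ← Real.rpow_neg h0.le] at h4
  rw [abs_le]
  constructor <;> linarith

lemma abs_log_cos_le {φ : ℝ} (hφ : φ ∈ Ioo 0 (Real.pi / 2)) :
    |Real.log (Real.cos φ)| ≤ 2 + 4 * (Real.pi / 2 - φ) ^ (-(1 / 4) : ℝ) := by
  have hv : 0 < Real.pi / 2 - φ := sub_pos.mpr hφ.2
  have hc := cos_pos_of_mem hφ
  have hle : (Real.pi / 2 - φ) / 2 ≤ Real.cos φ := by
    rw [← Real.sin_pi_div_two_sub]
    have h1 := Real.mul_le_sin hv.le (by linarith [hφ.1])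
    refine le_trans ?_ h1
    rw [div_eq_inv_mul]
    refine mul_le_mul_of_nonneg_right ?_ hv.le
    rw [inv_eq_one_div, div_le_div_iff₀ two_pos Real.pi_pos]
    linarith [Real.pi_le_four]
  have h1 := Real.log_le_log (by positivity) hle
  rw [Real.log_div hv.ne' two_ne_zero] at h1
  have h2 := (abs_le.mp (abs_log_le_rpow hv (by linarith [hφ.1, Real.pi_le_four]))).1
  have h3 := Real.log_two_lt_d9
  rw [abs_of_nonpos (Real.log_nonpos hc.le (Real.cos_le_one φ))]
  linarith

/-- Concavity of sin on [0, π]: aφ is the convex combination of aπ/2 and 0 with weight 2φ/π on the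
former. -/
lemma mul_le_sin_mul {a c φ : ℝ} (ha0 : 0 < a) (ha2 : a < 2)
    (hc : c ≤ Real.sin (a * (Real.pi / 2))) (hφ : φ ∈ Ioo 0 (Real.pi / 2)) :
    2 / Real.pi * φ * c ≤ Real.sin (a * φ) := by
  have hpi := Real.pi_pos
  have h0 : 0 ≤ 2 / Real.pi * φ := mul_nonneg (by positivity) hφ.1.le
  have h1 : 2 / Real.pi * φ ≤ 1 := by
    rw [div_mul_eq_mul_div, div_le_one hpi]
    linarith [hφ.2]
  have h := strictConcaveOn_sin_Icc.concaveOn.2 (x := a * (Real.pi / 2)) (y := 0)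
    ⟨by positivity, by nlinarith⟩ ⟨le_rfl, hpi.le⟩ h0 (sub_nonneg.mpr h1) (by ring)
  simp only [smul_eq_mul, Real.sin_zero, mul_zero, add_zero] at h
  rw [show 2 / Real.pi * φ * (a * (Real.pi / 2)) = a * φ by field_simp] at h
  exact (mul_le_mul_of_nonneg_left hc h0).trans h

/-- Because sin(aπ/2) = cos((a - 1)π/2) and cos decreases with |(a - 1)φ|, the constant bounding the
sine also serves here. -/
lemma le_cos_sub_one_mul {a c φ : ℝ} (ha0 : 0 < a) (ha2 : a < 2)
    (hc : c ≤ Real.sin (a * (Real.pi / 2))) (hφ : φ ∈ Ioo 0 (Real.pi / 2)) :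
    c ≤ Real.cos ((a - 1) * φ) := by
  have hpi := Real.pi_pos
  have h1 : Real.sin (a * (Real.pi / 2)) = Real.cos (|a - 1| * (Real.pi / 2)) := by
    rw [← Real.cos_abs (|a - 1| * (Real.pi / 2)), abs_mul, abs_abs, ← abs_mul, Real.cos_abs,
      sub_mul, one_mul, Real.cos_sub_pi_div_two]
  have h2 : |a - 1| ≤ 1 := abs_le.mpr ⟨by linarith, by linarith⟩
  rw [← Real.cos_abs ((a - 1) * φ), abs_mul, abs_of_pos hφ.1]
  refine (hc.trans_eq h1).trans (Real.cos_le_cos_of_nonneg_of_le_pi ?_ ?_ ?_)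
  · exact mul_nonneg (abs_nonneg _) hφ.1.le
  · nlinarith
  · exact mul_le_mul_of_nonneg_left hφ.2.le (abs_nonneg _)

lemma abs_log_base_le {a c x φ : ℝ} (ha0 : 0 < a) (ha2 : a < 2) (hx : 0 < x) (hc0 : 0 < c)
    (hc : c ≤ Real.sin (a * (Real.pi / 2))) (hφ : φ ∈ Ioo 0 (Real.pi / 2)) :
    |Real.log (|x * Real.cos φ / Real.sin (a * φ)|)| ≤
      (|Real.log x| + |Real.log (2 / Real.pi * c)| + 4) * majorant φ := by
  have hcos := cos_pos_of_mem hφ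
  have hsin := sin_mul_pos ha0 ha2.le hφ
  have hφ0 := hφ.1
  have h1 := abs_log_cos_le hφ
  have h2 := abs_log_le_rpow hφ0 (by linarith [hφ.2, Real.pi_le_four])
  have h3 : |Real.log (Real.sin (a * φ))| ≤ |Real.log (2 / Real.pi * c)| + |Real.log φ| := by
    have h4 : 2 / Real.pi * c * φ ≤ Real.sin (a * φ) := by
      have := mul_le_sin_mul ha0 ha2 hc hφ
      linarith [mul_right_comm (2 / Real.pi) c φ]
    have h5 := Real.log_le_log (by positivity) h4
    rw [Real.log_mul (by positivity) hφ0.ne'] at h5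
    rw [abs_of_nonpos (Real.log_nonpos hsin.le (Real.sin_le_one _))]
    linarith [neg_abs_le (Real.log (2 / Real.pi * c)), neg_abs_le (Real.log φ)]
  rw [Real.log_abs, Real.log_div (by positivity) hsin.ne', Real.log_mul hx.ne' hcos.ne']
  have h4 := (abs_sub (Real.log x + Real.log (Real.cos φ)) (Real.log (Real.sin (a * φ)))).trans
    (add_le_add_left (abs_add_le _ _) _)
  have hu := Real.rpow_nonneg hφ0.le (-(1 / 4))
  have hv := Real.rpow_nonneg (sub_pos.mpr hφ.2).le (-(1 / 4))
  have h6 := one_le_majorant hφ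
  have h7 := mul_le_mul_of_nonneg_left h6
    (add_nonneg (abs_nonneg (Real.log x)) (abs_nonneg (Real.log (2 / Real.pi * c))))
  have h8 : 4 * majorant φ =
    4 + 4 * φ ^ (-(1 / 4) : ℝ) + 4 * (Real.pi / 2 - φ) ^ (-(1 / 4) : ℝ) := by
    rw [majorant]
    ring
  linarith

/-! ### Derivatives of `g` in α and their uniform bounds -/

/-- The part of the `α`-derivative of `-(h₁ + h₂ + h₃)` coming from squares of `sin` and `cos`. -/
def sqTerm (φ α : ℝ) : ℝ :=
  α / (α - 1) * (φ ^ 2 / Real.sin (α * φ) ^ 2) - φ ^ 2 / Real.cos ((α - 1) * φ) ^ 2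

lemma h2_eq (φ α : ℝ) :
    h2 φ α = α * φ / (α - 1) * (Real.cos (α * φ) / Real.sin (α * φ)) := by
  rw [h2, Real.tan_eq_sin_div_cos, one_div_div]

lemma h3_eq (φ α : ℝ) :
    h3 φ α = φ * (Real.sin ((α - 1) * φ) / Real.cos ((α - 1) * φ)) := by
  rw [h3, Real.tan_eq_sin_div_cos]

lemma measurable_h1 (α x : ℝ) : Measurable fun φ => h1 φ α x := by
  have : Measurable fun φ => x * Real.cos φ / Real.sin (α * φ) := by fun_prop
  unfold h1
  simp only [Real.log_abs]
  fun_prop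

lemma measurable_h2 (α : ℝ) : Measurable fun φ => h2 φ α := by
  simp only [h2_eq]
  fun_prop

lemma measurable_h3 (α : ℝ) : Measurable fun φ => h3 φ α := by
  simp only [h3_eq]
  fun_prop

lemma measurable_sqTerm (α : ℝ) : Measurable fun φ => sqTerm φ α := by
  unfold sqTerm
  fun_prop

lemma hasDerivAt_sin_mul (α φ : ℝ) :
    HasDerivAt (fun a => Real.sin (a * φ)) (Real.cos (α * φ) * φ) α := by
  simpa using ((hasDerivAt_id α).mul_const φ).sin

lemma hasDerivAt_cos_mul (α φ : ℝ) :
    HasDerivAt (fun a => Real.cos (a * φ)) (-Real.sin (α * φ) * φ) α := by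
  simpa using ((hasDerivAt_id α).mul_const φ).cos

lemma hasDerivAt_sin_sub_one_mul (α φ : ℝ) :
    HasDerivAt (fun a => Real.sin ((a - 1) * φ)) (Real.cos ((α - 1) * φ) * φ) α := by
  simpa using (((hasDerivAt_id α).sub_const 1).mul_const φ).sin

lemma hasDerivAt_cos_sub_one_mul (α φ : ℝ) :
    HasDerivAt (fun a => Real.cos ((a - 1) * φ)) (-Real.sin ((α - 1) * φ) * φ) α := by
  simpa using (((hasDerivAt_id α).sub_const 1).mul_const φ).cos

lemma hasDerivAt_base {α φ : ℝ} (x : ℝ) (hs : Real.sin (α * φ) ≠ 0) :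
    HasDerivAt (fun a => x * Real.cos φ / Real.sin (a * φ))
      (-(x * Real.cos φ / Real.sin (α * φ)) *
        (φ * (Real.cos (α * φ) / Real.sin (α * φ)))) α := by
  refine ((hasDerivAt_const α (x * Real.cos φ)).fun_div (hasDerivAt_sin_mul α φ) hs).congr_deriv ?_
  field_simp
  ring

lemma hasDerivAt_exponent {α : ℝ} (hα1 : α ≠ 1) :
    HasDerivAt (fun a : ℝ => a / (a - 1)) (-1 / (α - 1) ^ 2) α := by
  have h : α - 1 ≠ 0 := sub_ne_zero.mpr hα1
  refine ((hasDerivAt_id' α).fun_div ((hasDerivAt_id' α).sub_const 1) h).congr_deriv ?_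
  ring

lemma hasDerivAt_g_alpha {α x φ : ℝ} (hα0 : 0 < α) (hα2 : α ≤ 2) (hα1 : α ≠ 1) (hx : 0 < x)
    (hφ : φ ∈ Ioo 0 (Real.pi / 2)) :
    HasDerivAt (fun a => g φ a x) (-g φ α x * (h1 φ α x + h2 φ α + h3 φ α)) α := by
  have h : α - 1 ≠ 0 := sub_ne_zero.mpr hα1
  have hs := (sin_mul_pos hα0 hα2 hφ).ne'
  have hc := (cos_pos_of_mem hφ).ne'
  have hc1 := (cos_sub_one_mul_pos hα0 hα2 hφ).ne'
  have hL := base_pos hα0 hα2 hx hφ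
  have hd := ((hasDerivAt_base x hs).rpow (hasDerivAt_exponent hα1) hL).fun_mul
    ((hasDerivAt_cos_sub_one_mul α φ).div_const (Real.cos φ))
  refine hd.congr_deriv ?_
  rw [g, h1, h2_eq, h3_eq, Real.log_abs, Real.rpow_sub_one hL.ne']
  have hL' := hL.ne'
  generalize (x * Real.cos φ / Real.sin (α * φ)) ^ (α / (α - 1)) = p
  generalize x * Real.cos φ / Real.sin (α * φ) = L at hL' ⊢
  generalize Real.sin (α * φ) = s at *
  generalize Real.cos ((α - 1) * φ) = c' at *
  field_simp
  ring

lemma hasDerivAt_neg_rate {α x φ : ℝ} (hα0 : 0 < α) (hα2 : α ≤ 2) (hα1 : α ≠ 1) (hx : 0 < x)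
    (hφ : φ ∈ Ioo 0 (Real.pi / 2)) :
    HasDerivAt (fun a => -(h1 φ a x + h2 φ a + h3 φ a))
      (2 / (α - 1) * h1 φ α x + 2 / (α * (α - 1)) * h2 φ α + sqTerm φ α) α := by
  have h : α - 1 ≠ 0 := sub_ne_zero.mpr hα1
  have hs := (sin_mul_pos hα0 hα2 hφ).ne'
  have hc1 := (cos_sub_one_mul_pos hα0 hα2 hφ).ne'
  have hL := (base_pos hα0 hα2 hx hφ).ne'
  have hα := hα0.ne'
  simp only [h1, h2_eq, h3_eq, Real.log_abs]
  have d1 := (((hasDerivAt_const α (1 : ℝ)).fun_div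
    (((hasDerivAt_id' α).sub_const 1).fun_pow 2) (pow_ne_zero 2 h)).fun_mul
      ((hasDerivAt_base x hs).log hL))
  have d2 := (((hasDerivAt_id' α).mul_const φ).fun_div ((hasDerivAt_id' α).sub_const 1) h).fun_mul
    ((hasDerivAt_cos_mul α φ).fun_div (hasDerivAt_sin_mul α φ) hs)
  have d3 := ((hasDerivAt_sin_sub_one_mul α φ).fun_div (hasDerivAt_cos_sub_one_mul α φ)
    hc1).const_mul φ
  refine ((d1.fun_add d2).fun_add d3).fun_neg.congr_deriv ?_
  have t1 := Real.sin_sq_add_cos_sq (α * φ)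
  have t2 := Real.sin_sq_add_cos_sq ((α - 1) * φ)
  rw [sqTerm]
  generalize Real.log (x * Real.cos φ / Real.sin (α * φ)) = l
  generalize x * Real.cos φ / Real.sin (α * φ) = L at hL ⊢
  generalize Real.sin (α * φ) = s at *
  generalize Real.cos (α * φ) = c at *
  generalize Real.sin ((α - 1) * φ) = s' at *
  generalize Real.cos ((α - 1) * φ) = c' at *
  have e1 : c ^ 2 = 1 - s ^ 2 := by linarith
  have e2 : s' ^ 2 = 1 - c' ^ 2 := by linarith
  field_simp
  ring_nf
  simp only [e1, e2]
  ring

/-- By continuity, a, |a - 1| and sin(aπ/2) stay above half their values at α. The last quantity is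
positive only for α < 2, and it controls every denominator depending on φ. -/
lemma exists_uniform_bounds {α x : ℝ} (hα0 : 0 < α) (hα2 : α < 2) (hα1 : α ≠ 1) (hx : 0 < x) :
    ∃ ε > 0, ∃ K : ℝ, 0 ≤ K ∧ ∀ a ∈ Metric.ball α ε, 0 < a ∧ a < 2 ∧ a ≠ 1 ∧
      |2 / (a - 1)| ≤ K ∧ |2 / (a * (a - 1))| ≤ K ∧ ∀ φ ∈ Ioo 0 (Real.pi / 2),
        |h1 φ a x| ≤ K * majorant φ ∧ |h2 φ a| ≤ K * majorant φ ∧ |h3 φ a| ≤ K * majorant φ ∧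
        |sqTerm φ a| ≤ K * majorant φ := by
  have hs := sin_mul_pi_div_two_pos hα0 hα2
  have hd : 0 < |α - 1| := abs_pos.mpr (sub_ne_zero.mpr hα1)
  set c := Real.sin (α * (Real.pi / 2)) / 2 with hc
  set δ := |α - 1| / 2 with hδ
  set η := α / 2 with hη
  have hc0 : 0 < c := by positivity
  have hδ0 : 0 < δ := by positivity
  have hη0 : 0 < η := by positivity
  have hpi := Real.pi_pos
  set B := Real.pi / 2 / c with hB
  have hB0 : 0 < B := by positivity
  set Λ := |Real.log x| + |Real.log (2 / Real.pi * c)| + 4 with hΛ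
  have hΛ0 : 0 < Λ := by positivity
  have hev : ∀ᶠ a in 𝓝 α, η < a ∧ a < 2 ∧ δ < |a - 1| ∧ c < Real.sin (a * (Real.pi / 2)) := by
    refine (eventually_gt_nhds (by linarith)).and ((eventually_lt_nhds hα2).and
      (Eventually.and ?_ ?_))
    · exact (Continuous.tendsto (f := fun a : ℝ => |a - 1|) (by fun_prop) α).eventually_const_lt
        (by linarith)
    · exact (Continuous.tendsto (f := fun a : ℝ => Real.sin (a * (Real.pi / 2))) (by fun_prop)
        α).eventually_const_lt (by linarith)
  obtain ⟨ε, hε, hball⟩ := Metric.eventually_nhds_iff_ball.mp hev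
  -- K is the sum of the bounds needed: two for the coefficients, then those for `h1`, `h2`, `h3`
  -- and `sqTerm`. B bounds both φ / sin(aφ) and φ / cos((a - 1)φ).
  refine ⟨ε, hε, 2 / δ + 2 / (η * δ) + Λ / δ ^ 2 + 2 / δ * B + B + (2 / δ * B ^ 2 + B ^ 2),
    by positivity, fun a ha => ?_⟩
  obtain ⟨ha0, ha2, had, hac⟩ := hball a ha
  have ha00 : 0 < a := hη0.trans ha0
  have hda : 0 < |a - 1| := hδ0.trans had
  have hinv : |a - 1|⁻¹ ≤ δ⁻¹ := inv_anti₀ hδ0 had.le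
  have p1 : 0 < 2 / δ := by positivity
  have p2 : 0 < 2 / (η * δ) := by positivity
  have p3 : 0 < Λ / δ ^ 2 := by positivity
  have p4 : 0 < 2 / δ * B := by positivity
  have p5 : 0 < 2 / δ * B ^ 2 + B ^ 2 := by positivity
  refine ⟨ha00, ha2, fun h => by simp [h] at hda, ?_, ?_, fun φ hφ => ?_⟩
  · have : |2 / (a - 1)| ≤ 2 / δ := by
      rw [abs_div, abs_two]
      gcongr
    linarith
  · have : |2 / (a * (a - 1))| ≤ 2 / (η * δ) := by
      rw [abs_div, abs_two, abs_mul, abs_of_pos ha00]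
      gcongr
    linarith
  have hm := one_le_majorant hφ
  have hφ0 := hφ.1
  have hsin := sin_mul_pos ha00 ha2.le hφ
  have hcos := cos_sub_one_mul_pos ha00 ha2.le hφ
  have b1 : φ / Real.sin (a * φ) ≤ B := by
    rw [div_le_iff₀ hsin]
    have h := mul_le_mul_of_nonneg_left (mul_le_sin_mul ha00 ha2 hac.le hφ) hB0.le
    refine le_of_eq_of_le ?_ h
    rw [hB]
    field_simp
  have b2 : φ / Real.cos ((a - 1) * φ) ≤ B := by
    rw [hB]
    have := le_cos_sub_one_mul ha00 ha2 hac.le hφ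
    have := hφ.2.le
    gcongr
  have b1' : 0 ≤ φ / Real.sin (a * φ) := by positivity
  have b2' : 0 ≤ φ / Real.cos ((a - 1) * φ) := by positivity
  have key : ∀ {y T : ℝ}, |y| ≤ T → T ≤ 2 / δ + 2 / (η * δ) + Λ / δ ^ 2 + 2 / δ * B + B +
      (2 / δ * B ^ 2 + B ^ 2) → |y| ≤ (2 / δ + 2 / (η * δ) + Λ / δ ^ 2 + 2 / δ * B + B +
      (2 / δ * B ^ 2 + B ^ 2)) * majorant φ := by
    intro y T h1 h2
    refine (h1.trans h2).trans (le_mul_of_one_le_right ?_ hm)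
    positivity
  have b3 : |a / (a - 1)| ≤ 2 / δ := by
    rw [abs_div, abs_of_pos ha00]
    gcongr
  refine ⟨?_, key (T := 2 / δ * B) ?_ ?_, key (T := B) ?_ ?_,
    key (T := 2 / δ * B ^ 2 + B ^ 2) ?_ ?_⟩
  · have h := abs_log_base_le ha00 ha2 hx hc0 hac.le hφ
    have h2 : |h1 φ a x| ≤ Λ / δ ^ 2 * majorant φ := by
      rw [h1, abs_mul, abs_div, abs_one, abs_pow, div_mul_eq_mul_div, div_mul_eq_mul_div, one_mul]
      gcongr
    refine h2.trans (mul_le_mul_of_nonneg_right ?_ (by linarith))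
    linarith
  · rw [h2_eq, show a * φ / (a - 1) * (Real.cos (a * φ) / Real.sin (a * φ)) =
      a / (a - 1) * (φ / Real.sin (a * φ) * Real.cos (a * φ)) by ring, abs_mul, abs_mul,
      abs_of_nonneg b1']
    refine mul_le_mul b3 ?_ (by positivity) (by positivity)
    exact (mul_le_of_le_one_right b1' (Real.abs_cos_le_one _)).trans b1
  · linarith
  · rw [h3_eq, show φ * (Real.sin ((a - 1) * φ) / Real.cos ((a - 1) * φ)) =
      φ / Real.cos ((a - 1) * φ) * Real.sin ((a - 1) * φ) by ring, abs_mul, abs_of_nonneg b2']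
    exact (mul_le_of_le_one_right b2' (Real.abs_sin_le_one _)).trans b2
  · linarith
  · rw [sqTerm, ← div_pow, ← div_pow]
    refine (abs_sub _ _).trans (add_le_add ?_ ?_)
    · rw [abs_mul, abs_pow, abs_of_nonneg b1']
      gcongr
    · rw [abs_pow, abs_of_nonneg b2']
      gcongr
  · linarith

/-! ### Derivatives in x -/

lemma hasDerivAt_g_x {α x φ : ℝ} (hα0 : 0 < α) (hα2 : α ≤ 2) (hx : 0 < x)
    (hφ : φ ∈ Ioo 0 (Real.pi / 2)) :
    HasDerivAt (fun y => g φ α y) (g φ α x * (α / (α - 1) / x)) x := by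
  have hL := base_pos hα0 hα2 hx hφ
  have hs := (sin_mul_pos hα0 hα2 hφ).ne'
  have hc := (cos_pos_of_mem hφ).ne'
  have hd : HasDerivAt (fun y => y * Real.cos φ / Real.sin (α * φ))
      (Real.cos φ / Real.sin (α * φ)) x := by
    simpa using ((hasDerivAt_id x).mul_const (Real.cos φ)).div_const (Real.sin (α * φ))
  refine ((hd.rpow_const (p := α / (α - 1)) (Or.inl hL.ne')).mul_const
    (Real.cos ((α - 1) * φ) / Real.cos φ)).congr_deriv ?_
  rw [g, Real.rpow_sub_one hL.ne']
  generalize (x * Real.cos φ / Real.sin (α * φ)) ^ (α / (α - 1)) = p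
  field_simp

lemma intervalIntegrable_mul_bounded {k v m : ℝ → ℝ} {A B : ℝ} (hk : Measurable k)
    (hv : Measurable v) (hm : IntervalIntegrable m volume 0 (Real.pi / 2)) (hA : 0 ≤ A)
    (hkb : ∀ φ ∈ Ioo 0 (Real.pi / 2), |k φ| ≤ A)
    (hvb : ∀ φ ∈ Ioo 0 (Real.pi / 2), |v φ| ≤ B * m φ) :
    IntervalIntegrable (fun φ => k φ * v φ) volume 0 (Real.pi / 2) := by
  refine intervalIntegrable_of_le (hk.mul hv).aestronglyMeasurable (hm.const_mul (A * B))
    fun φ hφ => ?_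
  rw [abs_mul, mul_assoc]
  exact mul_le_mul (hkb φ hφ) (hvb φ hφ) (abs_nonneg _) hA

lemma integral_congr_Ioo {k k' : ℝ → ℝ} (h : ∀ φ ∈ Ioo 0 (Real.pi / 2), k φ = k' φ) :
    ∫ φ in (0 : ℝ)..(Real.pi / 2), k φ = ∫ φ in (0 : ℝ)..(Real.pi / 2), k' φ :=
  intervalIntegral.integral_congr_ae (ae_mem_Ioo_of_mem_uIoc h)

lemma intervalIntegrable_congr_Ioo {k k' : ℝ → ℝ}
    (hk : IntervalIntegrable k volume 0 (Real.pi / 2))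
    (h : ∀ φ ∈ Ioo 0 (Real.pi / 2), k φ = k' φ) :
    IntervalIntegrable k' volume 0 (Real.pi / 2) := by
  have hp : (0 : ℝ) ≤ Real.pi / 2 := by positivity
  rw [intervalIntegrable_iff_integrableOn_Ioo_of_le hp] at hk ⊢
  exact hk.congr_fun h measurableSet_Ioo

section SpaceVariable

variable {α x : ℝ}

lemma intervalIntegrable_g_mul_one_sub (hα0 : 0 < α) (hα2 : α ≤ 2) (hx : 0 < x) :
    IntervalIntegrable (fun φ => g φ α x * (1 - g φ α x) * Real.exp (-g φ α x))
      volume 0 (Real.pi / 2) := by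
  have hm := measurable_g α x
  exact intervalIntegrable_of_le (bound := fun _ => 3)
    (Measurable.aestronglyMeasurable (by fun_prop)) (by simp)
    fun φ hφ => abs_mul_one_sub_mul_exp_le (g_pos hα0 hα2 hx hφ).le

lemma intervalIntegrable_g_sq_mul_two_sub (hα0 : 0 < α) (hα2 : α ≤ 2) (hx : 0 < x) :
    IntervalIntegrable (fun φ => g φ α x ^ 2 * (2 - g φ α x) * Real.exp (-g φ α x))
      volume 0 (Real.pi / 2) := by
  have hm := measurable_g α x
  exact intervalIntegrable_of_le (bound := fun _ => 10)
    (Measurable.aestronglyMeasurable (by fun_prop)) (by simp)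
    fun φ hφ => abs_sq_mul_two_sub_mul_exp_le (g_pos hα0 hα2 hx hφ).le

/-- `g` is homogeneous in x of degree β = α/(α - 1), so its logarithmic derivative β/x leaves the
integral. The second derivative splits by y(y² - 3y + 1) = y(1 - y) - y²(2 - y), whose first part is
again the integral in f'. -/
lemma hasDerivAt_integral_x (hα0 : 0 < α) (hα2 : α ≤ 2) (hx : 0 < x) :
    HasDerivAt (fun y => ∫ φ in (0 : ℝ)..(Real.pi / 2), g φ α y * Real.exp (-g φ α y))
      (α / (α - 1) / x *
        ∫ φ in (0 : ℝ)..(Real.pi / 2), g φ α x * (1 - g φ α x) * Real.exp (-g φ α x)) x ∧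
    HasDerivAt (fun y => α / (α - 1) / y *
        ∫ φ in (0 : ℝ)..(Real.pi / 2), g φ α y * (1 - g φ α y) * Real.exp (-g φ α y))
      ((α / (α - 1) / x) ^ 2 *
        ((∫ φ in (0 : ℝ)..(Real.pi / 2), g φ α x * (1 - g φ α x) * Real.exp (-g φ α x)) -
          ∫ φ in (0 : ℝ)..(Real.pi / 2), g φ α x ^ 2 * (2 - g φ α x) * Real.exp (-g φ α x)) -
        α / (α - 1) / x ^ 2 *
          ∫ φ in (0 : ℝ)..(Real.pi / 2), g φ α x * (1 - g φ α x) * Real.exp (-g φ α x)) x := by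
  set β := α / (α - 1)
  have hball : ∀ y ∈ Metric.ball x (x / 2), x / 2 < y := fun y hy => by
    rw [Metric.mem_ball, Real.dist_eq, abs_lt] at hy
    linarith [hy.1]
  have hx2 : 0 < x / 2 := by positivity
  have hK : ∀ {u φ : ℝ}, φ ∈ Ioo 0 (Real.pi / 2) → |u| ≤ |β| / (x / 2) + |β| / (x / 2) ^ 2 →
      |u| ≤ (|β| / (x / 2) + |β| / (x / 2) ^ 2) * majorant φ := fun hφ h =>
    h.trans (le_mul_of_one_le_right (by positivity) (one_le_majorant hφ))
  have h := hasDerivAt_integral_mul_exp_neg (G := fun y φ => g φ α y) (W := fun y _ => β / y)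
    (W' := fun y _ => -β / y ^ 2) (m := majorant) (s₀ := x) (ε := x / 2)
    (K := |β| / (x / 2) + |β| / (x / 2) ^ 2) hx2 intervalIntegrable_majorant_sq
    (fun φ hφ => one_le_majorant hφ) (fun y => measurable_g α y) (fun _ => measurable_const)
    (fun _ => measurable_const)
    (fun y hy φ hφ => (g_pos hα0 hα2 (hx2.trans (hball y hy)) hφ).le)
    (fun y hy φ hφ => hasDerivAt_g_x hα0 hα2 (hx2.trans (hball y hy)) hφ)
    (fun y hy φ hφ => by
      have hy0 : y ≠ 0 := (hx2.trans (hball y hy)).ne'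
      refine ((hasDerivAt_const y β).fun_div (hasDerivAt_id' y) hy0).congr_deriv ?_
      ring)
    (fun y hy φ hφ => by
      have hy0 := hball y hy
      have h1 : |β / y| ≤ |β| / (x / 2) := by
        rw [abs_div, abs_of_pos (hx2.trans hy0)]
        gcongr
      have : 0 ≤ |β| / (x / 2) ^ 2 := by positivity
      exact hK hφ (by linarith))
    (fun y hy φ hφ => by
      have hy0 := hball y hy
      have h1 : |-β / y ^ 2| ≤ |β| / (x / 2) ^ 2 := by
        rw [abs_div, abs_neg, abs_pow, abs_of_pos (hx2.trans hy0)]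
        gcongr
      have : 0 ≤ |β| / (x / 2) := by positivity
      exact hK hφ (by linarith))
  have hF1 : ∀ y, ∫ φ in (0 : ℝ)..(Real.pi / 2),
      g φ α y * (β / y) * (1 - g φ α y) * Real.exp (-g φ α y) = β / y *
        ∫ φ in (0 : ℝ)..(Real.pi / 2), g φ α y * (1 - g φ α y) * Real.exp (-g φ α y) := fun y => by
    rw [← intervalIntegral.integral_const_mul]
    congr 1
    funext φ
    ring
  obtain ⟨hd1, hd2⟩ := h
  have hd1 := hd1 x (Metric.mem_ball_self hx2)
  simp only [hF1] at hd1 hd2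
  refine ⟨hd1, hd2.congr_deriv ?_⟩
  have i1 := intervalIntegrable_g_mul_one_sub hα0 hα2 hx
  have i2 := intervalIntegrable_g_sq_mul_two_sub hα0 hα2 hx
  rw [← intervalIntegral.integral_sub i1 i2, ← intervalIntegral.integral_const_mul,
    ← intervalIntegral.integral_const_mul,
    ← intervalIntegral.integral_sub ((i1.sub i2).const_mul _) (i1.const_mul _)]
  congr 1
  funext φ
  ring

lemma hasDerivAt_density_x (hα0 : 0 < α) (hα2 : α ≤ 2) (hα1 : α ≠ 1) (hx : 0 < x) :
    HasDerivAt (fun y => density y α)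
      (-(1 / x) * density x α + α / (Real.pi * |α - 1| * x) * (α / (α - 1) / x *
        ∫ φ in (0 : ℝ)..(Real.pi / 2), g φ α x * (1 - g φ α x) * Real.exp (-g φ α x))) x := by
  have hne : Real.pi * |α - 1| ≠ 0 :=
    mul_ne_zero Real.pi_ne_zero (abs_ne_zero.mpr (sub_ne_zero.mpr hα1))
  have hC : HasDerivAt (fun y => α / (Real.pi * |α - 1| * y))
      (-(1 / x) * (α / (Real.pi * |α - 1| * x))) x := by
    refine ((hasDerivAt_const x α).fun_div ((hasDerivAt_id' x).const_mul (Real.pi * |α - 1|))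
      (mul_ne_zero hne hx.ne')).congr_deriv ?_
    field_simp
    ring
  refine ((hC.fun_mul (hasDerivAt_integral_x hα0 hα2 hx).1).congr_of_eventuallyEq
    ?_).congr_deriv ?_
  · filter_upwards [eventually_gt_nhds hx] with y hy using density_eq_integral hα0 hα2 hα1 hy
  · rw [density_eq_integral hα0 hα2 hα1 hx]
    ring

lemma hasDerivAt_densityX (hα0 : 0 < α) (hα2 : α ≤ 2) (hα1 : α ≠ 1) (hx : 0 < x) :
    HasDerivAt (fun y => densityX y α)
      (1 / (α - 1) * (1 / x ^ 2) * density x α +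
        (3 - 2 * α) / (α - 1) * (1 / x) * densityX x α -
        α / (Real.pi * |α - 1| * x) * (α / (α - 1) / x) ^ 2 *
          ∫ φ in (0 : ℝ)..(Real.pi / 2), g φ α x ^ 2 * (2 - g φ α x) *
            Real.exp (-g φ α x)) x := by
  have hne1 : α - 1 ≠ 0 := sub_ne_zero.mpr hα1
  have hne : Real.pi * |α - 1| ≠ 0 := mul_ne_zero Real.pi_ne_zero (abs_ne_zero.mpr hne1)
  have hC : HasDerivAt (fun y => α / (Real.pi * |α - 1| * y))
      (-(1 / x) * (α / (Real.pi * |α - 1| * x))) x := by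
    refine ((hasDerivAt_const x α).fun_div ((hasDerivAt_id' x).const_mul (Real.pi * |α - 1|))
      (mul_ne_zero hne hx.ne')).congr_deriv ?_
    field_simp
    ring
  have hinv : HasDerivAt (fun y : ℝ => -(1 / y)) (1 / x ^ 2) x := by
    refine ((hasDerivAt_const x (1 : ℝ)).fun_div (hasDerivAt_id' x) hx.ne').fun_neg.congr_deriv ?_
    ring
  have hfx := hasDerivAt_density_x hα0 hα2 hα1 hx
  refine (((hinv.fun_mul hfx).fun_add (hC.fun_mul
    (hasDerivAt_integral_x hα0 hα2 hx).2)).congr_of_eventuallyEq ?_).congr_deriv ?_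
  · filter_upwards [eventually_gt_nhds hx] with y hy using
      (hasDerivAt_density_x hα0 hα2 hα1 hy).deriv
  · rw [densityX, hfx.deriv]
    generalize |α - 1| = b at hne ⊢
    have hb : b ≠ 0 := right_ne_zero_of_mul hne
    have hpi := Real.pi_ne_zero
    have hx0 := hx.ne'
    field_simp
    ring

end SpaceVariable

/-! ### Derivatives in α -/

section IndexVariable

variable {α x : ℝ}

lemma hasDerivAt_integral_alpha (hα0 : 0 < α) (hα2 : α < 2) (hα1 : α ≠ 1) (hx : 0 < x) :
    HasDerivAt (fun a => ∫ φ in (0 : ℝ)..(Real.pi / 2), g φ a x * Real.exp (-g φ a x))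
      (∫ φ in (0 : ℝ)..(Real.pi / 2), gAlpha φ α x * (1 - g φ α x) * Real.exp (-g φ α x)) α ∧
    HasDerivAt (fun a => ∫ φ in (0 : ℝ)..(Real.pi / 2),
        gAlpha φ a x * (1 - g φ a x) * Real.exp (-g φ a x))
      (∫ φ in (0 : ℝ)..(Real.pi / 2),
        (g φ α x * (g φ α x ^ 2 - 3 * g φ α x + 1) * (h1 φ α x + h2 φ α + h3 φ α) ^ 2 *
            Real.exp (-g φ α x) +
          g φ α x * (2 / (α - 1) * h1 φ α x + 2 / (α * (α - 1)) * h2 φ α + sqTerm φ α) *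
            (1 - g φ α x) * Real.exp (-g φ α x))) α := by
  obtain ⟨ε, hε, K, hK0, hK⟩ := exists_uniform_bounds hα0 hα2 hα1 hx
  have hmeas := fun a => measurable_g a x
  have hmeas1 := fun a => measurable_h1 a x
  have hmeas2 := measurable_h2
  have hmeas3 := measurable_h3
  have hmeas4 := measurable_sqTerm
  have h := hasDerivAt_integral_mul_exp_neg (G := fun a φ => g φ a x)
    (W := fun a φ => -(h1 φ a x + h2 φ a + h3 φ a))
    (W' := fun a φ => 2 / (a - 1) * h1 φ a x + 2 / (a * (a - 1)) * h2 φ a + sqTerm φ a)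
    -- The rate needs 3K; its derivative needs 2K² + K, from two coefficient products and `sqTerm`.
    (m := majorant) (s₀ := α) (ε := ε) (K := 3 * K + 2 * K ^ 2) hε intervalIntegrable_majorant_sq
    (fun φ hφ => one_le_majorant hφ) hmeas
    (fun a => (((hmeas1 a).add (hmeas2 a)).add (hmeas3 a)).neg)
    (fun a => (((hmeas1 a).const_mul _).add ((hmeas2 a).const_mul _)).add (hmeas4 a))
    (fun a ha φ hφ => (g_pos (hK a ha).1 (hK a ha).2.1.le hx hφ).le)
    (fun a ha φ hφ => (hasDerivAt_g_alpha (hK a ha).1 (hK a ha).2.1.le (hK a ha).2.2.1 hx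
      hφ).congr_deriv (by ring))
    (fun a ha φ hφ => hasDerivAt_neg_rate (hK a ha).1 (hK a ha).2.1.le (hK a ha).2.2.1 hx hφ)
    (fun a ha φ hφ => by
      obtain ⟨-, -, -, -, -, hb⟩ := hK a ha
      obtain ⟨b1, b2, b3, -⟩ := hb φ hφ
      have hm := one_le_majorant hφ
      have : 0 ≤ 2 * K ^ 2 * majorant φ := by positivity
      rw [abs_neg]
      have := abs_add_three (h1 φ a x) (h2 φ a) (h3 φ a)
      linarith)
    (fun a ha φ hφ => by
      obtain ⟨-, -, -, c1, c2, hb⟩ := hK a ha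
      obtain ⟨b1, b2, -, b4⟩ := hb φ hφ
      have hm := one_le_majorant hφ
      have : 0 ≤ 2 * (K * majorant φ) := by positivity
      have e1 := mul_le_mul c1 b1 (abs_nonneg _) hK0
      have e2 := mul_le_mul c2 b2 (abs_nonneg _) hK0
      rw [← abs_mul] at e1 e2
      have := abs_add_three (2 / (a - 1) * h1 φ a x) (2 / (a * (a - 1)) * h2 φ a) (sqTerm φ a)
      linarith)
  have hα := Metric.mem_ball_self (x := α) hε
  have hF1 : ∀ a ∈ Metric.ball α ε, ∫ φ in (0 : ℝ)..(Real.pi / 2),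
      g φ a x * -(h1 φ a x + h2 φ a + h3 φ a) * (1 - g φ a x) * Real.exp (-g φ a x) =
        ∫ φ in (0 : ℝ)..(Real.pi / 2), gAlpha φ a x * (1 - g φ a x) * Real.exp (-g φ a x) :=
    fun a ha => integral_congr_Ioo fun φ hφ => by
      rw [gAlpha, (hasDerivAt_g_alpha (hK a ha).1 (hK a ha).2.1.le (hK a ha).2.2.1 hx hφ).deriv]
      ring
  obtain ⟨hd1, hd2⟩ := h
  refine ⟨(hd1 α hα).congr_deriv (hF1 α hα), (hd2.congr_of_eventuallyEq ?_).congr_deriv ?_⟩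
  · filter_upwards [Metric.ball_mem_nhds α hε] with a ha using (hF1 a ha).symm
  · simp only [neg_sq]

lemma intervalIntegrable_alpha (hα0 : 0 < α) (hα2 : α < 2) (hα1 : α ≠ 1) (hx : 0 < x) :
    IntervalIntegrable (fun φ => gAlpha φ α x * (1 - g φ α x) * Real.exp (-g φ α x))
      volume 0 (Real.pi / 2) ∧
    IntervalIntegrable (fun φ => g φ α x *
      ((1 + α) * h1 φ α x + 2 * h2 φ α + h3 φ α) * (1 - g φ α x) * Real.exp (-g φ α x))
      volume 0 (Real.pi / 2) ∧
    IntervalIntegrable (fun φ => g φ α x * (g φ α x ^ 2 - 3 * g φ α x + 1) *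
      (h1 φ α x + h2 φ α + h3 φ α) ^ 2 * Real.exp (-g φ α x)) volume 0 (Real.pi / 2) ∧
    IntervalIntegrable (fun φ => g φ α x * sqTerm φ α * (1 - g φ α x) * Real.exp (-g φ α x))
      volume 0 (Real.pi / 2) := by
  obtain ⟨ε, hε, K, hK0, hK⟩ := exists_uniform_bounds hα0 hα2 hα1 hx
  obtain ⟨-, -, -, -, -, hb⟩ := hK α (Metric.mem_ball_self hε)
  have hmeas := measurable_g α x
  have hmeas1 := measurable_h1 α x
  have hmeas2 := measurable_h2 α
  have hmeas3 := measurable_h3 α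
  have hmeas4 := measurable_sqTerm α
  have hsq : ∀ φ ∈ Ioo 0 (Real.pi / 2), majorant φ ≤ majorant φ ^ 2 := fun φ hφ => by
    nlinarith [one_le_majorant hφ]
  have hlin : ∀ v : ℝ → ℝ, Measurable v → ∀ B : ℝ, 0 ≤ B →
      (∀ φ ∈ Ioo 0 (Real.pi / 2), |v φ| ≤ B * majorant φ) →
      IntervalIntegrable (fun φ => g φ α x * (1 - g φ α x) * Real.exp (-g φ α x) * v φ)
        volume 0 (Real.pi / 2) := fun v hv B hB hvb =>
    intervalIntegrable_mul_bounded (A := 3) (by fun_prop) hv intervalIntegrable_majorant_sq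
      (by norm_num) (fun φ hφ => abs_mul_one_sub_mul_exp_le (g_pos hα0 hα2.le hx hφ).le)
      fun φ hφ => (hvb φ hφ).trans (mul_le_mul_of_nonneg_left (hsq φ hφ) hB)
  have hrate : ∀ φ ∈ Ioo 0 (Real.pi / 2),
      |h1 φ α x + h2 φ α + h3 φ α| ≤ 3 * K * majorant φ := fun φ hφ => by
    obtain ⟨b1, b2, b3, -⟩ := hb φ hφ
    have := abs_add_three (h1 φ α x) (h2 φ α) (h3 φ α)
    linarith
  refine ⟨?_, ?_, ?_, ?_⟩
  · refine intervalIntegrable_congr_Ioo (hlin (fun φ => -(h1 φ α x + h2 φ α + h3 φ α))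
      (by fun_prop) (3 * K) (by positivity) fun φ hφ => ?_) fun φ hφ => ?_
    · rw [abs_neg]
      exact hrate φ hφ
    · rw [gAlpha, (hasDerivAt_g_alpha hα0 hα2.le hα1 hx hφ).deriv]
      ring
  · refine intervalIntegrable_congr_Ioo (hlin (fun φ => (1 + α) * h1 φ α x + 2 * h2 φ α + h3 φ α)
      (by fun_prop) ((1 + α) * K + 2 * K + K) (by positivity) fun φ hφ => ?_) fun φ hφ => by ring
    obtain ⟨b1, b2, b3, -⟩ := hb φ hφ
    have := abs_add_three ((1 + α) * h1 φ α x) (2 * h2 φ α) (h3 φ α)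
    rw [abs_mul, abs_mul, abs_two, abs_of_pos (by positivity : 0 < 1 + α)] at this
    have := mul_le_mul_of_nonneg_left b1 (by positivity : 0 ≤ 1 + α)
    linarith
  · refine intervalIntegrable_congr_Ioo (intervalIntegrable_mul_bounded (A := 13)
      (B := (3 * K) ^ 2) (k := fun φ => g φ α x * (g φ α x ^ 2 - 3 * g φ α x + 1) *
        Real.exp (-g φ α x)) (v := fun φ => (h1 φ α x + h2 φ α + h3 φ α) ^ 2)
      (by fun_prop) (by fun_prop) intervalIntegrable_majorant_sq (by norm_num)
      (fun φ hφ => abs_mul_quadratic_mul_exp_le (g_pos hα0 hα2.le hx hφ).le) fun φ hφ => ?_)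
      fun φ hφ => by ring
    rw [abs_pow, ← mul_pow]
    exact pow_le_pow_left₀ (abs_nonneg _) (hrate φ hφ) 2
  · exact intervalIntegrable_congr_Ioo (hlin (fun φ => sqTerm φ α) hmeas4 K hK0
      fun φ hφ => (hb φ hφ).2.2.2) fun φ hφ => by ring

lemma hasDerivAt_prefactor (hα0 : 0 < α) (hα1 : α ≠ 1) (hx : 0 < x) :
    HasDerivAt (fun a => a / (Real.pi * |a - 1| * x))
      (1 / (α * (1 - α)) * (α / (Real.pi * |α - 1| * x))) α := by
  have hne : α - 1 ≠ 0 := sub_ne_zero.mpr hα1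
  have hne' : 1 - α ≠ 0 := sub_ne_zero.mpr hα1.symm
  have hpi := Real.pi_ne_zero
  -- Locally |a - 1| = σ (a - 1) with σ = ±1, and σ does not affect the logarithmic derivative.
  have key : ∀ σ : ℝ, σ ≠ 0 → HasDerivAt (fun a => a / (Real.pi * (σ * (a - 1)) * x))
      (1 / (α * (1 - α)) * (α / (Real.pi * (σ * (α - 1)) * x))) α := fun σ hσ => by
    refine ((hasDerivAt_id' α).fun_div (((((hasDerivAt_id' α).sub_const 1).const_mul σ).const_mul
      Real.pi).mul_const x) (by positivity)).congr_deriv ?_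
    field_simp
    ring
  rcases lt_or_gt_of_ne hα1 with h | h
  · have e : ∀ a : ℝ, a < 1 → |a - 1| = -1 * (a - 1) := fun a ha => by
      rw [abs_of_neg (by linarith)]
      ring
    rw [e α h]
    refine (key (-1) (by norm_num)).congr_of_eventuallyEq ?_
    filter_upwards [eventually_lt_nhds h] with a ha
    rw [e a ha]
  · have e : ∀ a : ℝ, 1 < a → |a - 1| = 1 * (a - 1) := fun a ha => by
      rw [abs_of_pos (by linarith)]
      ring
    rw [e α h]
    refine (key 1 (by norm_num)).congr_of_eventuallyEq ?_
    filter_upwards [eventually_gt_nhds h] with a ha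
    rw [e a ha]

lemma hasDerivAt_density_alpha (hα0 : 0 < α) (hα2 : α < 2) (hα1 : α ≠ 1) (hx : 0 < x) :
    HasDerivAt (fun a => density x a)
      (1 / (α * (1 - α)) * density x α + α / (Real.pi * |α - 1| * x) *
        ∫ φ in (0 : ℝ)..(Real.pi / 2), gAlpha φ α x * (1 - g φ α x) *
          Real.exp (-g φ α x)) α := by
  refine (((hasDerivAt_prefactor hα0 hα1 hx).fun_mul
    (hasDerivAt_integral_alpha hα0 hα2 hα1 hx).1).congr_of_eventuallyEq ?_).congr_deriv ?_
  · filter_upwards [eventually_gt_nhds hα0, eventually_lt_nhds hα2, eventually_ne_nhds hα1]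
      with a h0 h2 h1 using density_eq_integral h0 h2.le h1 hx
  · rw [density_eq_integral hα0 hα2.le hα1 hx]
    ring

/-- The combination α h₁ + h₂ in the derivative of the rate is written as ((1 + α)h₁ + 2h₂ + h₃) -
(h₁ + h₂ + h₃). The subtracted part reproduces the integral of `gAlpha`, with coefficient exactly
cancelling the two cross terms of the product rule. -/
lemma hasDerivAt_densityAlpha (hα0 : 0 < α) (hα2 : α < 2) (hα1 : α ≠ 1) (hx : 0 < x) :
    HasDerivAt (fun a => densityAlpha x a)
      (2 / (α * (1 - α) ^ 2) * density x α +
        α / (Real.pi * |α - 1| * x) * (2 / (α * (α - 1))) *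
          (∫ φ in (0 : ℝ)..(Real.pi / 2), g φ α x *
            ((1 + α) * h1 φ α x + 2 * h2 φ α + h3 φ α) * (1 - g φ α x) * Real.exp (-g φ α x)) +
        α / (Real.pi * |α - 1| * x) *
          (∫ φ in (0 : ℝ)..(Real.pi / 2), g φ α x * (g φ α x ^ 2 - 3 * g φ α x + 1) *
            (h1 φ α x + h2 φ α + h3 φ α) ^ 2 * Real.exp (-g φ α x)) +
        α / (Real.pi * |α - 1| * x) *
          ∫ φ in (0 : ℝ)..(Real.pi / 2), g φ α x * sqTerm φ α *
            (1 - g φ α x) * Real.exp (-g φ α x)) α := by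
  have hne : α - 1 ≠ 0 := sub_ne_zero.mpr hα1
  have hne' : 1 - α ≠ 0 := sub_ne_zero.mpr hα1.symm
  have hα := hα0.ne'
  have hD : HasDerivAt (fun a : ℝ => 1 / (a * (1 - a)))
      (-(1 - 2 * α) / (α * (1 - α)) ^ 2) α := by
    refine ((hasDerivAt_const α (1 : ℝ)).fun_div ((hasDerivAt_id' α).fun_mul
      ((hasDerivAt_id' α).const_sub 1)) (mul_ne_zero hα hne')).congr_deriv ?_
    ring
  obtain ⟨i1, i2, i3, i4⟩ := intervalIntegrable_alpha hα0 hα2 hα1 hx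
  have hsplit : ∫ φ in (0 : ℝ)..(Real.pi / 2),
        (g φ α x * (g φ α x ^ 2 - 3 * g φ α x + 1) * (h1 φ α x + h2 φ α + h3 φ α) ^ 2 *
            Real.exp (-g φ α x) +
          g φ α x * (2 / (α - 1) * h1 φ α x + 2 / (α * (α - 1)) * h2 φ α + sqTerm φ α) *
            (1 - g φ α x) * Real.exp (-g φ α x)) =
      (∫ φ in (0 : ℝ)..(Real.pi / 2), g φ α x * (g φ α x ^ 2 - 3 * g φ α x + 1) *
        (h1 φ α x + h2 φ α + h3 φ α) ^ 2 * Real.exp (-g φ α x)) +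
      (∫ φ in (0 : ℝ)..(Real.pi / 2), g φ α x * sqTerm φ α *
        (1 - g φ α x) * Real.exp (-g φ α x)) +
      2 / (α * (α - 1)) * ((∫ φ in (0 : ℝ)..(Real.pi / 2), g φ α x *
        ((1 + α) * h1 φ α x + 2 * h2 φ α + h3 φ α) * (1 - g φ α x) * Real.exp (-g φ α x)) +
        ∫ φ in (0 : ℝ)..(Real.pi / 2), gAlpha φ α x * (1 - g φ α x) * Real.exp (-g φ α x)) := by
    rw [← intervalIntegral.integral_add i2 i1, ← intervalIntegral.integral_const_mul,
      ← intervalIntegral.integral_add i3 i4,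
      ← intervalIntegral.integral_add (i3.add i4) ((i2.add i1).const_mul _)]
    refine integral_congr_Ioo fun φ hφ => ?_
    rw [gAlpha, (hasDerivAt_g_alpha hα0 hα2.le hα1 hx hφ).deriv]
    field_simp
    ring
  refine (((hD.fun_mul (hasDerivAt_density_alpha hα0 hα2 hα1 hx)).fun_add
    ((hasDerivAt_prefactor hα0 hα1 hx).fun_mul
      (hasDerivAt_integral_alpha hα0 hα2 hα1 hx).2)).congr_of_eventuallyEq ?_).congr_deriv ?_
  · filter_upwards [eventually_gt_nhds hα0, eventually_lt_nhds hα2, eventually_ne_nhds hα1]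
      with a h0 h2 h1 using (hasDerivAt_density_alpha h0 h2 h1 hx).deriv
  · rw [hsplit]
    have e : 2 / (α * (α - 1)) = -(2 / (α * (1 - α))) := by
      rw [← div_neg]
      congr 1
      ring
    -- With D = 1/(α(1 - α)), the coefficient of f is D' + D²: D' from differentiating D, D² from
    -- substituting f_α.
    have e2 : 2 / (α * (1 - α) ^ 2) =
        -(1 - 2 * α) / (α * (1 - α)) ^ 2 + (1 / (α * (1 - α))) ^ 2 := by
      field_simp
      ring
    rw [e, e2]
    ring

end IndexVariable

end SymStable

end

theorem mainTheorem3 (α x : ℝ) (hα0 : 0 < α) (hα2 : α ≤ 2) (hα1 : α ≠ 1) (hx : 0 < x) :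
    -- the integrals in the formulas for `f'` and `f''` converge
    (IntervalIntegrable (fun φ : ℝ => SymStable.g φ α x * (1 - SymStable.g φ α x) *
        Real.exp (-SymStable.g φ α x)) MeasureTheory.volume 0 (Real.pi / 2) ∧
      IntervalIntegrable (fun φ : ℝ => SymStable.g φ α x ^ 2 * (2 - SymStable.g φ α x) *
        Real.exp (-SymStable.g φ α x)) MeasureTheory.volume 0 (Real.pi / 2)) ∧
    -- `f'(x; α)`
    HasDerivAt (fun y : ℝ => SymStable.density y α)
      (-(1 / x) * SymStable.density x α +
        α ^ 2 * Real.sign (α - 1) / (Real.pi * x ^ 2 * (α - 1) ^ 2) *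
          ∫ φ in (0 : ℝ)..(Real.pi / 2), SymStable.g φ α x * (1 - SymStable.g φ α x) *
            Real.exp (-SymStable.g φ α x)) x ∧
    -- `f''(x; α)`
    HasDerivAt (fun y : ℝ => SymStable.densityX y α)
      (1 / (α - 1) * (1 / x ^ 2) * SymStable.density x α +
        (3 - 2 * α) / (α - 1) * (1 / x) * SymStable.densityX x α -
        α ^ 3 * Real.sign (α - 1) / (Real.pi * (α - 1) ^ 3 * x ^ 3) *
          ∫ φ in (0 : ℝ)..(Real.pi / 2), SymStable.g φ α x ^ 2 * (2 - SymStable.g φ α x) *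
            Real.exp (-SymStable.g φ α x)) x ∧
    -- `g_α = -g (h₁ + h₂ + h₃)`
    (∀ φ ∈ Set.Ioo 0 (Real.pi / 2),
      HasDerivAt (fun a : ℝ => SymStable.g φ a x)
        (-SymStable.g φ α x *
          (SymStable.h1 φ α x + SymStable.h2 φ α + SymStable.h3 φ α)) α) ∧
    (α < 2 →
      -- the integrals in the formulas for `f_α` and `f_αα` converge
      (IntervalIntegrable (fun φ : ℝ => SymStable.gAlpha φ α x * (1 - SymStable.g φ α x) *
          Real.exp (-SymStable.g φ α x)) MeasureTheory.volume 0 (Real.pi / 2) ∧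
        IntervalIntegrable (fun φ : ℝ => SymStable.g φ α x *
          ((1 + α) * SymStable.h1 φ α x + 2 * SymStable.h2 φ α + SymStable.h3 φ α) *
          (1 - SymStable.g φ α x) * Real.exp (-SymStable.g φ α x))
          MeasureTheory.volume 0 (Real.pi / 2) ∧
        IntervalIntegrable (fun φ : ℝ => SymStable.g φ α x *
          (SymStable.g φ α x ^ 2 - 3 * SymStable.g φ α x + 1) *
          (SymStable.h1 φ α x + SymStable.h2 φ α + SymStable.h3 φ α) ^ 2 *
          Real.exp (-SymStable.g φ α x)) MeasureTheory.volume 0 (Real.pi / 2) ∧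
        IntervalIntegrable (fun φ : ℝ => SymStable.g φ α x *
          (α / (α - 1) * (φ ^ 2 / Real.sin (α * φ) ^ 2) -
            φ ^ 2 / Real.cos ((α - 1) * φ) ^ 2) *
          (1 - SymStable.g φ α x) * Real.exp (-SymStable.g φ α x))
          MeasureTheory.volume 0 (Real.pi / 2)) ∧
      -- `f_α(x; α)`
      HasDerivAt (fun a : ℝ => SymStable.density x a)
        (1 / (α * (1 - α)) * SymStable.density x α +
          α / (Real.pi * |α - 1| * x) *
            ∫ φ in (0 : ℝ)..(Real.pi / 2), SymStable.gAlpha φ α x * (1 - SymStable.g φ α x) *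
              Real.exp (-SymStable.g φ α x)) α ∧
      -- `f_αα(x; α)`
      HasDerivAt (fun a : ℝ => SymStable.densityAlpha x a)
        (2 / (α * (1 - α) ^ 2) * SymStable.density x α +
          2 * Real.sign (α - 1) / (Real.pi * (α - 1) ^ 2 * x) *
            (∫ φ in (0 : ℝ)..(Real.pi / 2), SymStable.g φ α x *
              ((1 + α) * SymStable.h1 φ α x + 2 * SymStable.h2 φ α + SymStable.h3 φ α) *
              (1 - SymStable.g φ α x) * Real.exp (-SymStable.g φ α x)) +
          α / (Real.pi * |α - 1| * x) *
            (∫ φ in (0 : ℝ)..(Real.pi / 2), SymStable.g φ α x *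
              (SymStable.g φ α x ^ 2 - 3 * SymStable.g φ α x + 1) *
              (SymStable.h1 φ α x + SymStable.h2 φ α + SymStable.h3 φ α) ^ 2 *
              Real.exp (-SymStable.g φ α x)) +
          α / (Real.pi * |α - 1| * x) *
            ∫ φ in (0 : ℝ)..(Real.pi / 2), SymStable.g φ α x *
              (α / (α - 1) * (φ ^ 2 / Real.sin (α * φ) ^ 2) -
                φ ^ 2 / Real.cos ((α - 1) * φ) ^ 2) *
              (1 - SymStable.g φ α x) * Real.exp (-SymStable.g φ α x)) α) := by
  have hne : α - 1 ≠ 0 := sub_ne_zero.mpr hα1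
  have hsign : 1 / |α - 1| = Real.sign (α - 1) / (α - 1) := by
    rcases lt_or_gt_of_ne hne with h | h
    · rw [Real.sign_of_neg h, abs_of_neg h, div_neg, neg_div]
    · rw [Real.sign_of_pos h, abs_of_pos h]
  have hpre : α / (Real.pi * |α - 1| * x) =
      α / (Real.pi * x) * (Real.sign (α - 1) / (α - 1)) := by
    rw [← hsign]
    ring
  refine ⟨⟨SymStable.intervalIntegrable_g_mul_one_sub hα0 hα2 hx,
    SymStable.intervalIntegrable_g_sq_mul_two_sub hα0 hα2 hx⟩,
    (SymStable.hasDerivAt_density_x hα0 hα2 hα1 hx).congr_deriv ?_,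
    (SymStable.hasDerivAt_densityX hα0 hα2 hα1 hx).congr_deriv ?_,
    fun φ hφ => SymStable.hasDerivAt_g_alpha hα0 hα2 hα1 hx hφ, fun hα2' =>
    ⟨SymStable.intervalIntegrable_alpha hα0 hα2' hα1 hx,
      SymStable.hasDerivAt_density_alpha hα0 hα2' hα1 hx,
      (SymStable.hasDerivAt_densityAlpha hα0 hα2' hα1 hx).congr_deriv ?_⟩⟩
  · rw [hpre]
    field_simp
  · rw [hpre]
    field_simp
  · have hpre2 : α / (Real.pi * |α - 1| * x) * (2 / (α * (α - 1))) =
        2 * Real.sign (α - 1) / (Real.pi * (α - 1) ^ 2 * x) := by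
      rw [hpre]
      field_simp
    rw [hpre2]
    -- What remains differs only by unfolding `sqTerm`.
    rfl
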